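/- For $\alpha,\beta>0$ write $$\mathrm{D}_+(\alpha,\beta)=\Big(\frac{\sqrt\alpha-\sqrt\beta}{\sqrt2}\Big)^2,\qquad \mathrm{T}_c(\alpha,\beta)=\frac{\alpha+\beta}{2}.$$ For $n\ge1$ and $p,q,s\in[0,1]$, the correlated stochastic block model $(G_1,G_2)\sim\mathrm{CSBM}(n,p,q,s)$ is defined as follows. Draw community labels $\sigma_*(i)\in\{+1,-1\}$, $i\in[n]$, i.i.d. uniformly at random. Given $\sigma_*$, draw a parent graph $G$ on $[n]$ in which distinct vertices $i,j$ are adjacent, independently over unordered pairs, with probability $p$ if $\sigma_*(i)=\sigma_*(j)$ and with probability $q$ otherwise. Given $G$, form $G_1$ by keeping each edge of $G$ independently with probability $s$, and form $G_2'$ independently in the same way. Let $\pi_*$ be a uniformly random permutation of $[n]$, independent of everything else, and let $G_2$ be obtained from $G_2'$ by relabelling each vertex $i$ as $\pi_*(i)$. The overlap of two labelings $\sigma,\tau\in\{+1,-1\}^n$ is $\mathsf{ov}(\sigma,\tau)=\frac1n\big|\sum_{i=1}^n\sigma(i)\tau(i)\big|$; it equals $1$ if and only if $\sigma=\tau$ or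 $\sigma=-\tau$. **Theorem.** Fix constants $\alpha,\beta>0$ and $s\in[0,1]$. For all $n$ large enough that $\alpha\frac{\log n}{n},\beta\frac{\log n}{n}\le1$, let $(G_1,G_2)\sim\mathrm{CSBM}\big(n,\alpha\frac{\log n}{n},\beta\frac{\log n}{n},s\big)$. Suppose that $$\big(1-(1-s)^2\big)\,\mathrm{D}_+(\alpha,\beta)<1$$ or that $$s^2\,\mathrm{T}_c(\alpha,\beta)+s(1-s)\,\mathrm{D}_+(\alpha,\beta)<1.$$ Then for any estimator $\widetilde\sigma=\widetilde\sigma(G_1,G_2)$, that is, any sequence of functions assigning to a pair of graphs on $[n]$ a labeling in $\{+1,-1\}^n$, $$\lim_{n\to\infty}\mathbb{P}\big(\mathsf{ov}(\widetilde\sigma(G_1,G_2),\sigma_*)=1\big)=0.$$ -/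

import Mathlib

open Filter Topology

namespace CorrelatedSBM

/-- The Chernoff-Hellinger divergence `D₊(α, β) = ((√α - √β) / √2)²`. -/
noncomputable def DPlus (α β : ℝ) : ℝ := ((√α - √β) / √2) ^ 2

/-- The connectivity threshold `T_c(α, β) = (α + β) / 2`. -/
noncomputable def Tc (α β : ℝ) : ℝ := (α + β) / 2

/-- Community labelings of `n` vertices; `ℤˣ` is the set `{+1, -1}`. -/
abbrev Labeling (n : ℕ) : Type := Fin n → ℤˣ

/-- The overlap `(1 / n) |∑ i, a i * b i|` of two labelings. -/
noncomputable def overlap {n : ℕ} (a b : Labeling n) : ℝ :=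
  (1 / (n : ℝ)) * |∑ i, ((a i : ℤ) : ℝ) * ((b i : ℤ) : ℝ)|

/-- The joint law of independent random variables with laws `P i`, for `i` in a finite type. -/
noncomputable def indep {ι : Type} [Fintype ι] [DecidableEq ι] {κ : Type} [Fintype κ]
    (P : ι → PMF κ) : PMF (ι → κ) :=
  PMF.ofFintype (fun x => ∏ i, P i (x i)) (by
    have h : ∀ i, ∑ a, P i a = 1 := fun i => by
      rw [← tsum_fintype (L := .unconditional _)]
      exact (P i).tsum_coe
    rw [← Fintype.prod_sum (fun i a => P i a)]
    simp [h])

/-- The Bernoulli distribution of a Boolean with parameter `p ∈ [0, 1]`. -/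
noncomputable def bern (p : unitInterval) : PMF Bool :=
  PMF.ofFintype (fun b => ENNReal.ofReal (if b then (p : ℝ) else 1 - p)) (by
    rw [Fintype.sum_bool, if_pos rfl, if_neg (by simp),
      ← ENNReal.ofReal_add p.2.1 (sub_nonneg.2 p.2.2)]
    simp)

/-- A random graph on `n` labelled vertices in which every pair `e` of distinct vertices is an
edge with probability `w e`, independently over the pairs (`SimpleGraph.fromEdgeSet` discards the
degenerate pairs on the diagonal). -/
noncomputable def randomGraph {n : ℕ} (w : Sym2 (Fin n) → unitInterval) : PMF (SimpleGraph (Fin n)) :=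
  (indep fun e => bern (w e)).map fun x => SimpleGraph.fromEdgeSet {e | x e = true}

open Classical in
/-- The stochastic block model conditioned on its community labels `σ`: two distinct vertices are
adjacent with probability `p` if they have the same label, and with probability `q` otherwise.
(The unordered pair `e.map σ` of labels is diagonal if and only if the two labels agree.) -/
noncomputable def blockGraph {n : ℕ} (p q : unitInterval) (σ : Labeling n) :
    PMF (SimpleGraph (Fin n)) :=
  randomGraph fun e => if (e.map σ).IsDiag then p else q

open Classical in
/-- Keep each edge of `G` with probability `s`, independently; non-edges remain non-edges. -/
noncomputable def subsample {n : ℕ} (s : unitInterval) (G : SimpleGraph (Fin n)) :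
    PMF (SimpleGraph (Fin n)) :=
  randomGraph fun e => if e ∈ G.edgeSet then s else 0

/-- An outcome of the correlated stochastic block model: the community labels `σ` (of the vertices
of the first graph), the hidden permutation `π`, and the two graphs `G₁` and `G₂`. -/
structure Outcome (n : ℕ) where
  σ : Labeling n
  π : Equiv.Perm (Fin n)
  G₁ : SimpleGraph (Fin n)
  G₂ : SimpleGraph (Fin n)

/-- All sets of outcomes are events. -/
instance (n : ℕ) : MeasurableSpace (Outcome n) := ⊤

/-- The correlated stochastic block model `CSBM(n, p, q, s)`: i.i.d. uniform labels `σ`; a parent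
graph `G` drawn from the block model with labels `σ`; two independent subsamplings `G₁`, `G₂'` of
`G`; an independent uniformly random permutation `π`; and `G₂`, which is `G₂'` with each vertex `i`
relabelled as `π i`. -/
noncomputable def CSBM (n : ℕ) (p q s : unitInterval) : PMF (Outcome n) :=
  (indep fun _ : Fin n => PMF.uniformOfFintype ℤˣ).bind fun σ =>
  (blockGraph p q σ).bind fun G =>
  (subsample s G).bind fun G₁ =>
  (subsample s G).bind fun G₂' =>
  (PMF.uniformOfFintype (Equiv.Perm (Fin n))).bind fun π =>
  PMF.pure ⟨σ, π, G₁, G₂'.map π⟩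

/-- An estimator of the community labels on `n` vertices is a function of the two graphs. -/
abbrev Estimator (n : ℕ) : Type :=
  SimpleGraph (Fin n) → SimpleGraph (Fin n) → Labeling n

end CorrelatedSBM

open CorrelatedSBM

/-! Exact recovery fails because the truth has many rivals that give the same observation and are at
least as likely. An outcome is encoded by its labels, by the two edge indicators of every pair
(independent over pairs given the labels), and by the permutation. Pair types are declared marked or
neutral. A vertex of a block `H` is good if all its pairs inside `H` are neutral and, outside `H`,
it has exactly `k` marked pairs in each community and otherwise neutral ones. A good vertex has a
balanced neighborhood, which says nothing about its own label.

Two moves exploit this. If marked means "edge of the union graph", exchanging the labels of two good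
vertices leaves the likelihood unchanged (`edgeLaw_swap_union`). If marked means "edge of the first
graph only" and neutral "not an edge of the first graph", good vertices are isolated in the
intersection graph. Exchanging their labels together with their roles in the second graph, and
composing the permutation with the transposition, keeps the observation and does not decrease the
likelihood (`edgeLaw_le_swap_first`). If each of `K` disjoint blocks contains good vertices of both
labels, there are `K` distinct rivals, so an estimator succeeds there with probability at most `2 /
K` (`mul_success_inter_le`); the 2 is the global sign.

It remains to find good vertices. If a pair with edge probability `r` is marked with probability `r
* a` and neutral with probability `1 - r * b`, a Poisson estimate with `k` near `a * √(α * β) * log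
n / 2` gives goodness outside `H` probability about `n ^ (-θ)`, where `θ = b * (α + β) / 2 - a * √(α
* β)` (`exists_rpow_le_binomialWeight_mul`). For the union graph `a = b = 2 * s - s ^ 2`, and for
the first graph `a = s * (1 - s)`, `b = s`; the two values of `θ` are the two quantities in the
hypothesis. When `θ < 1`, blocks of size about `n ^ κ` with `θ < κ < 1` are large enough to contain
good vertices and small enough that their inner pairs rarely matter (`configLaw_compl_goodPair_le`,
`tendsto_success_zero`). -/

namespace CorrelatedSBM

/-! ### Finite products of laws -/

section Independence

variable {ι κ κ' : Type} [Fintype ι] [DecidableEq ι] [Fintype κ] [Fintype κ']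

lemma indep_apply (P : ι → PMF κ) (x : ι → κ) : indep P x = ∏ i, P i (x i) := rfl

/-- Distributivity of a finite product over sums. It lets the stages of the model (parent graph, two
subsamplings) be merged into one independent chain per pair. -/
lemma indep_bind (P : ι → PMF κ) (Q : ι → κ → PMF κ') :
    indep (fun i => (P i).bind (Q i)) = (indep P).bind fun x => indep fun i => Q i (x i) := by
  ext y
  simp only [PMF.bind_apply, indep_apply, tsum_fintype, ← Finset.prod_mul_distrib]
  rw [← Fintype.prod_sum (fun i a => P i a * Q i a (y i))]

lemma indep_pure (f : ι → κ) : indep (fun i => PMF.pure (f i)) = PMF.pure f := by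
  classical
  ext y
  simp only [indep_apply, PMF.pure_apply]
  by_cases h : y = f
  · subst h; simp
  · rw [if_neg h]
    obtain ⟨i, hi⟩ := Function.ne_iff.1 h
    exact Finset.prod_eq_zero (Finset.mem_univ i) (if_neg hi)

end Independence

/-! ### Reduction to independent edge indicators -/

/-- The graph whose edges are the non-degenerate pairs marked by `y`. -/
abbrev graphOf {n : ℕ} (y : Sym2 (Fin n) → Bool) : SimpleGraph (Fin n) :=
  SimpleGraph.fromEdgeSet {e | y e = true}

open Classical in
/-- The probability that a pair of vertices is an edge of the parent graph. -/
noncomputable def edgeProb {n : ℕ} (p q : unitInterval) (σ : Labeling n) (e : Sym2 (Fin n)) :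
    unitInterval :=
  if (e.map σ).IsDiag then p else q

open Classical in
/-- The joint law of the indicators that a pair is an edge of the two subsampled graphs, where the
pair is an edge of the parent graph with probability `r`, and `d` says whether it is degenerate. -/
noncomputable def pairLaw (r s : unitInterval) (d : Prop) : PMF (Bool × Bool) :=
  (bern r).bind fun g =>
  (bern (if g = true ∧ ¬ d then s else 0)).bind fun a =>
  (bern (if g = true ∧ ¬ d then s else 0)).bind fun b => PMF.pure (a, b)

/-- The law of the edge indicators of the two subsampled graphs given the labels. -/
noncomputable def edgeLaw {n : ℕ} (p q s : unitInterval) (σ : Labeling n) :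
    PMF (Sym2 (Fin n) → Bool × Bool) :=
  indep fun e => pairLaw (edgeProb p q σ e) s e.IsDiag

lemma edgeLaw_eq {n : ℕ} (p q s : unitInterval) (σ : Labeling n) (F : Type)
    (f : SimpleGraph (Fin n) → SimpleGraph (Fin n) → PMF F) :
    ((blockGraph p q σ).bind fun G => (subsample s G).bind fun G₁ =>
      (subsample s G).bind fun G₂ => f G₁ G₂) =
    (edgeLaw p q s σ).bind fun x =>
      f (graphOf fun e => (x e).1) (graphOf fun e => (x e).2) := by
  unfold edgeLaw pairLaw blockGraph subsample randomGraph
  rw [indep_bind]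
  simp only [indep_bind, indep_pure, PMF.bind_bind, PMF.bind_map, PMF.pure_bind,
    Function.comp_def, edgeProb]
  congr 1
  funext x
  have h : ∀ e, e ∈ (graphOf x).edgeSet ↔ x e = true ∧ ¬ e.IsDiag := by simp [graphOf]
  simp only [h]
  congr!

/-- Labels, edge indicators of the two subsampled graphs, and the hidden permutation. -/
abbrev Config (n : ℕ) : Type :=
  Labeling n × (Sym2 (Fin n) → Bool × Bool) × Equiv.Perm (Fin n)

/-- The joint law of a configuration. -/
noncomputable def configLaw (n : ℕ) (p q s : unitInterval) : PMF (Config n) :=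
  (indep fun _ : Fin n => PMF.uniformOfFintype ℤˣ).bind fun σ =>
  (edgeLaw p q s σ).bind fun x =>
  (PMF.uniformOfFintype (Equiv.Perm (Fin n))).bind fun π => PMF.pure (σ, x, π)

/-- The outcome of the correlated block model described by a configuration. -/
def Config.toOutcome {n : ℕ} (z : Config n) : Outcome n :=
  ⟨z.1, z.2.2, graphOf fun e => (z.2.1 e).1, (graphOf fun e => (z.2.1 e).2).map z.2.2⟩

lemma CSBM_eq_map (n : ℕ) (p q s : unitInterval) :
    CSBM n p q s = (configLaw n p q s).map Config.toOutcome := by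
  unfold CSBM configLaw
  simp only [PMF.map_bind, PMF.pure_map, Config.toOutcome]
  refine congrArg _ (funext fun σ => ?_)
  rw [edgeLaw_eq p q s σ _ (fun G₁ G₂ => (PMF.uniformOfFintype (Equiv.Perm (Fin n))).bind
    fun π => PMF.pure (⟨σ, π, G₁, G₂.map π⟩ : Outcome n))]

/-- The permutation enters only through a constant factor, so a move may change it freely when
likelihoods are compared. -/
lemma configLaw_apply {n : ℕ} (p q s : unitInterval) (z : Config n) :
    configLaw n p q s z = (indep fun _ : Fin n => PMF.uniformOfFintype ℤˣ) z.1 *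
      edgeLaw p q s z.1 z.2.1 * (Fintype.card (Equiv.Perm (Fin n)) : ENNReal)⁻¹ := by
  classical
  obtain ⟨σ, x, π⟩ := z
  simp only [configLaw, PMF.bind_apply, PMF.pure_apply, tsum_fintype, PMF.uniformOfFintype_apply,
    Prod.mk.injEq]
  rw [Finset.sum_eq_single σ (by intro b _ hb; simp [Ne.symm hb]) (by simp),
    Finset.sum_eq_single x (by intro b _ hb; simp [Ne.symm hb]) (by simp),
    Finset.sum_eq_single π (by intro b _ hb; simp [Ne.symm hb]) (by simp)]
  simp [mul_assoc]

/-! ### Counting rivals of a successful configuration -/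

/-- Two labelings of overlap one agree up to a global sign. -/
lemma eq_or_eq_neg_of_overlap_eq_one {n : ℕ} {a b : Labeling n} (h : overlap a b = 1) :
    b = a ∨ b = -a := by
  have hn : (n : ℝ) ≠ 0 := by
    intro h0
    simp [overlap, h0] at h
  have hs : |∑ i, ((a i : ℤ) : ℝ) * ((b i : ℤ) : ℝ)| = n := by
    unfold overlap at h
    field_simp at h
    exact h
  have hterm : ∀ i, ((a i : ℤ) : ℝ) * ((b i : ℤ) : ℝ) = 1 ∧ b i = a i ∨
      ((a i : ℤ) : ℝ) * ((b i : ℤ) : ℝ) = -1 ∧ b i = -a i := by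
    intro i
    rcases Int.units_eq_one_or (a i) with ha | ha <;>
      rcases Int.units_eq_one_or (b i) with hb | hb <;> simp [ha, hb]
  rcases abs_eq (by positivity : (0 : ℝ) ≤ n) |>.1 hs with h1 | h1
  · left
    have h0 : ∑ i, (1 - ((a i : ℤ) : ℝ) * ((b i : ℤ) : ℝ)) = 0 := by
      simp [Finset.sum_sub_distrib, h1]
    rw [Finset.sum_eq_zero_iff_of_nonneg
      (fun i _ => by rcases hterm i with h | h <;> linarith [h.1])] at h0
    funext i
    have := h0 i (Finset.mem_univ i)
    rcases hterm i with h | h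
    · exact h.2
    · linarith [h.1]
  · right
    have h0 : ∑ i, (1 + ((a i : ℤ) : ℝ) * ((b i : ℤ) : ℝ)) = 0 := by
      simp [Finset.sum_add_distrib, h1]
    rw [Finset.sum_eq_zero_iff_of_nonneg
      (fun i _ => by rcases hterm i with h | h <;> linarith [h.1])] at h0
    funext i
    have := h0 i (Finset.mem_univ i)
    rcases hterm i with h | h
    · linarith [h.1]
    · exact h.2

/-- The event that an estimator recovers the labels of a configuration up to a global sign. -/
def successSet {n : ℕ} (est : Estimator n) : Set (Config n) :=
  {z | overlap (est z.toOutcome.G₁ z.toOutcome.G₂) z.1 = 1}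

/-- If `f a ≠ f b`, the labeling obtained from `f` by exchanging the values at `a` and `b`
determines the transposition. -/
lemma swap_eq_swap_of_comp_eq {V κ : Type*} [DecidableEq V] {f : V → κ} {a b c d : V}
    (hab : f a ≠ f b) (hcd : f c ≠ f d)
    (h : f ∘ Equiv.swap a b = f ∘ Equiv.swap c d) :
    (a = c ∨ a = d) ∧ Equiv.swap a b = Equiv.swap c d := by
  have key : ∀ {a b c d : V}, f a ≠ f b → f ∘ Equiv.swap a b = f ∘ Equiv.swap c d →
      (a = c ∨ a = d) := by
    intro a b c d hab h
    by_contra hne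
    push Not at hne
    have := congrFun h a
    simp only [Function.comp, Equiv.swap_apply_left,
      Equiv.swap_apply_of_ne_of_ne hne.1 hne.2] at this
    exact hab this.symm
  have ha := key hab h
  have hb : b = c ∨ b = d := key hab.symm (by rw [Equiv.swap_comm b a]; exact h)
  refine ⟨ha, ?_⟩
  have hab' : a ≠ b := fun h => hab (by rw [h])
  rcases ha with rfl | rfl <;> rcases hb with rfl | rfl
  · exact absurd rfl hab'
  · rfl
  · exact Equiv.swap_comm _ _
  · exact absurd rfl hab'

/-- If every configuration in `⋂ j, G j` has, for each of `K` disjoint sets `H j`, an equally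
likely alternative with the same observation and the labels of two vertices of `H j` exchanged,
then an estimator succeeds there with probability at most `2 / K`. -/
lemma mul_success_inter_le {n K : ℕ} (P : PMF (Config n)) (est : Estimator n)
    (H : Fin K → Finset (Fin n)) (hH : Pairwise fun i j => Disjoint (H i) (H j))
    (Φ : Equiv.Perm (Fin n) → Config n → Config n)
    (hΦ : ∀ v w z, Φ (Equiv.swap v w) (Φ (Equiv.swap v w) z) = z)
    (hσ : ∀ τ z, (Φ τ z).1 = z.1 ∘ τ)
    (h₁ : ∀ τ z, (Φ τ z).toOutcome.G₁ = z.toOutcome.G₁)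
    (h₂ : ∀ v w z, (Φ (Equiv.swap v w) z).toOutcome.G₂ = z.toOutcome.G₂)
    (G : Fin K → Set (Config n))
    (hG : ∀ j, ∀ z ∈ G j, ∃ v ∈ H j, ∃ w ∈ H j,
      z.1 v ≠ z.1 w ∧ P z ≤ P (Φ (Equiv.swap v w) z)) :
    K * P.toOuterMeasure (successSet est ∩ ⋂ j, G j) ≤ 2 := by
  classical
  set S : Set (Config n) := successSet est ∩ ⋂ j, G j with hS
  have hex : ∀ jz : Fin K × S, ∃ vw : Fin n × Fin n, vw.1 ∈ H jz.1 ∧ vw.2 ∈ H jz.1 ∧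
      jz.2.1.1 vw.1 ≠ jz.2.1.1 vw.2 ∧ P jz.2 ≤ P (Φ (Equiv.swap vw.1 vw.2) jz.2) := by
    rintro ⟨j, z, hz⟩
    obtain ⟨v, hv, w, hw, h⟩ := hG j z (Set.mem_iInter.1 hz.2 j)
    exact ⟨(v, w), hv, hw, h⟩
  choose c hc₁ hc₂ hc₃ hc₄ using hex
  -- The flag records which of the two signs of the estimate is the true labeling. With it, the
  -- rival determines both the block and the original configuration; the two flag values produce the
  -- constant 2.
  let F : Fin K × S → Config n × Prop := fun jz =>
    (Φ (Equiv.swap (c jz).1 (c jz).2) jz.2,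
      jz.2.1.1 = est jz.2.1.toOutcome.G₁ jz.2.1.toOutcome.G₂)
  have hF : Function.Injective F := by
    rintro ⟨j, z⟩ ⟨j', z'⟩ h
    simp only [F, Prod.mk.injEq] at h
    obtain ⟨hy, hsign⟩ := h
    have e₁ : z.1.toOutcome.G₁ = z'.1.toOutcome.G₁ := by
      rw [← h₁ (Equiv.swap (c (j, z)).1 (c (j, z)).2) z, hy, h₁]
    have e₂ : z.1.toOutcome.G₂ = z'.1.toOutcome.G₂ := by
      rw [← h₂ (c (j, z)).1 (c (j, z)).2 z, hy, h₂]
    -- Both configurations give the same observation, hence the same estimate; success fixes the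
    -- labels up to sign and the flag fixes the sign.
    have hlab : z.1.1 = z'.1.1 := by
      have hz := eq_or_eq_neg_of_overlap_eq_one z.2.1
      have hz' := eq_or_eq_neg_of_overlap_eq_one z'.2.1
      rw [← e₁, ← e₂] at hz' hsign
      by_cases hs : z.1.1 = est z.1.toOutcome.G₁ z.1.toOutcome.G₂
      · rw [hs, (hsign ▸ hs : z'.1.1 = _)]
      · have hs' : ¬ z'.1.1 = est z.1.toOutcome.G₁ z.1.toOutcome.G₂ := hsign ▸ hs
        rw [hz.resolve_left hs, hz'.resolve_left hs']
    have hcomp := congrArg Prod.fst hy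
    rw [hσ, hσ, ← hlab] at hcomp
    have hne' := hc₃ (j', z')
    simp only [← hlab] at hne'
    obtain ⟨hmem, hsw⟩ := swap_eq_swap_of_comp_eq (hc₃ (j, z)) hne' hcomp
    -- The exchanged labeling determines the transposition, and its support lies in only one of the
    -- disjoint blocks.
    have hj : j = j' := by
      by_contra hj
      have := Finset.disjoint_left.1 (hH hj) (hc₁ (j, z))
      rcases hmem with hm | hm
      · exact this (hm ▸ hc₁ (j', z'))
      · exact this (hm ▸ hc₂ (j', z'))
    have hz : z.1 = z'.1 := by
      rw [← hΦ (c (j, z)).1 (c (j, z)).2 z.1, hy, hsw, hΦ]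
    rw [hj, Subtype.ext hz]
  have hsum : P.toOuterMeasure S = ∑ z : S, P z := by
    rw [PMF.toOuterMeasure_apply, ← tsum_subtype, tsum_fintype]
  calc (K : ENNReal) * P.toOuterMeasure S = ∑ jz : Fin K × S, P jz.2 := by
        rw [Fintype.sum_prod_type, hsum]; simp
    _ ≤ ∑ jz : Fin K × S, (fun yb : Config n × Prop => P yb.1) (F jz) :=
        Finset.sum_le_sum fun jz _ => hc₄ jz
    _ = ∑ yb ∈ Finset.univ.image F, P yb.1 := by
        rw [Finset.sum_image fun a _ b _ h => hF h]
    _ ≤ ∑ yb : Config n × Prop, P yb.1 :=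
        Finset.sum_le_sum_of_subset (Finset.subset_univ _)
    _ = 2 := by
        rw [Fintype.sum_prod_type]
        simp only [Finset.sum_const, Finset.card_univ, Fintype.card_prop]
        rw [← Finset.smul_sum, ← tsum_fintype (L := .unconditional _), P.tsum_coe]
        simp

lemma success_le {n K : ℕ} (hK : 0 < K) (P : PMF (Config n)) (est : Estimator n)
    (H : Fin K → Finset (Fin n)) (hH : Pairwise fun i j => Disjoint (H i) (H j))
    (Φ : Equiv.Perm (Fin n) → Config n → Config n)
    (hΦ : ∀ v w z, Φ (Equiv.swap v w) (Φ (Equiv.swap v w) z) = z)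
    (hσ : ∀ τ z, (Φ τ z).1 = z.1 ∘ τ)
    (h₁ : ∀ τ z, (Φ τ z).toOutcome.G₁ = z.toOutcome.G₁)
    (h₂ : ∀ v w z, (Φ (Equiv.swap v w) z).toOutcome.G₂ = z.toOutcome.G₂)
    (G : Fin K → Set (Config n))
    (hG : ∀ j, ∀ z ∈ G j, ∃ v ∈ H j, ∃ w ∈ H j,
      z.1 v ≠ z.1 w ∧ P z ≤ P (Φ (Equiv.swap v w) z)) :
    P.toOuterMeasure (successSet est) ≤ 2 / K + ∑ j, P.toOuterMeasure (G j)ᶜ := by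
  have hsub : successSet est ⊆ (successSet est ∩ ⋂ j, G j) ∪ ⋃ j, (G j)ᶜ := by
    intro z hz
    by_cases h : z ∈ ⋂ j, G j
    · exact Or.inl ⟨hz, h⟩
    · right
      rwa [← Set.compl_iInter]
  refine (MeasureTheory.measure_mono hsub).trans ((MeasureTheory.measure_union_le _ _).trans ?_)
  refine add_le_add ?_ (MeasureTheory.measure_iUnion_fintype_le _ _)
  rw [ENNReal.le_div_iff_mul_le (Or.inl (by exact_mod_cast hK.ne')) (Or.inl (by simp)), mul_comm]
  exact mul_success_inter_le P est H hH Φ hΦ hσ h₁ h₂ G hG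

/-! ### Likelihoods as products over pairs -/

/-- The weights of `pairLaw`, as real numbers. -/
noncomputable def pairWeight (r s : ℝ) : Bool × Bool → ℝ
  | (true, true) => r * s ^ 2
  | (true, false) => r * (s * (1 - s))
  | (false, true) => r * (s * (1 - s))
  | (false, false) => 1 - r * (2 * s - s ^ 2)

lemma pairWeight_nonneg (r s : unitInterval) (x : Bool × Bool) : 0 ≤ pairWeight r s x := by
  have hr := r.2.1
  have hr' := r.2.2
  have hs := s.2.1
  have hs' : 0 ≤ 1 - (s : ℝ) := sub_nonneg.2 s.2.2
  rcases x with ⟨_ | _, _ | _⟩ <;> simp only [pairWeight]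
  · nlinarith [mul_nonneg hs' hs', mul_nonneg hr (mul_nonneg hs' hs')]
  all_goals positivity

open Classical in
/-- The subsampling probability, set to zero on degenerate pairs. -/
noncomputable def keepProb (s : unitInterval) (d : Prop) : unitInterval := if d then 0 else s

lemma bern_apply (p : unitInterval) (b : Bool) :
    bern p b = ENNReal.ofReal (if b then (p : ℝ) else 1 - p) := rfl

lemma pairLaw_apply (r s : unitInterval) (d : Prop) (x : Bool × Bool) :
    pairLaw r s d x = ENNReal.ofReal (pairWeight r (keepProb s d) x) := by
  have key : ∀ t : unitInterval, (∑ g : Bool, bern r g * ∑ a : Bool,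
      bern (if g = true then t else 0) a * ∑ b : Bool, bern (if g = true then t else 0) b *
        PMF.pure (a, b) x) = ENNReal.ofReal (pairWeight r t x) := by
    intro t
    have hr := r.2.1
    have hr' : 0 ≤ 1 - (r : ℝ) := sub_nonneg.2 r.2.2
    have ht := t.2.1
    have ht' : 0 ≤ 1 - (t : ℝ) := sub_nonneg.2 t.2.2
    rcases x with ⟨_ | _, _ | _⟩ <;>
      simp only [Fintype.sum_bool, bern_apply, PMF.pure_apply, pairWeight] <;>
      simp <;>
      simp only [← ENNReal.ofReal_mul, hr, ht, ht']
    · rw [← ENNReal.ofReal_add (by positivity) hr']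
      congr 1
      ring
    · ring_nf
    · ring_nf
  rw [← key]
  simp only [pairLaw, PMF.bind_apply, tsum_fintype]
  by_cases hd : d <;> simp [keepProb, hd]

lemma edgeLaw_apply {n : ℕ} (p q s : unitInterval) (σ : Labeling n)
    (x : Sym2 (Fin n) → Bool × Bool) :
    edgeLaw p q s σ x = ENNReal.ofReal
      (∏ e, pairWeight (edgeProb p q σ e) (keepProb s e.IsDiag) (x e)) := by
  rw [ENNReal.ofReal_prod_of_nonneg fun e _ => pairWeight_nonneg _ _ _]
  simp only [edgeLaw, indep_apply, pairLaw_apply]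

lemma edgeProb_comp {n : ℕ} (p q : unitInterval) (σ : Labeling n) (τ : Equiv.Perm (Fin n))
    (e : Sym2 (Fin n)) : edgeProb p q (σ ∘ τ) e = edgeProb p q σ (e.map τ) := by
  simp [edgeProb, Sym2.map_map]

lemma isDiag_map_perm {V : Type*} (τ : Equiv.Perm V) (e : Sym2 V) :
    (e.map τ).IsDiag ↔ e.IsDiag := by
  induction e with
  | _ a b => simp

lemma map_swap_of_notMem {V : Type*} [DecidableEq V] {v w : V} {e : Sym2 V} (hv : v ∉ e)
    (hw : w ∉ e) : e.map (Equiv.swap v w) = e := by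
  induction e with
  | _ a b =>
    simp only [Sym2.mem_iff, not_or] at hv hw
    simp [Equiv.swap_apply_of_ne_of_ne (Ne.symm hv.1) (Ne.symm hw.1),
      Equiv.swap_apply_of_ne_of_ne (Ne.symm hv.2) (Ne.symm hw.2)]

/-- A product over all pairs, with the pairs that contain `v` or `w` split off. -/
lemma prod_sym2_split {V : Type*} [Fintype V] [DecidableEq V] {v w : V} (hvw : v ≠ w)
    (f : Sym2 V → ℝ) : ∏ e, f e = (∏ e with ¬ (v ∈ e ∨ w ∈ e), f e) *
      ((∏ u, f s(v, u)) * ∏ u ∈ Finset.univ.erase v, f s(w, u)) := by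
  have h₁ : ({e : Sym2 V | v ∈ e ∨ w ∈ e} : Finset (Sym2 V)) =
      Finset.univ.image (fun u => s(v, u)) ∪ (Finset.univ.erase v).image (fun u => s(w, u)) := by
    ext e
    induction e with
    | _ a b =>
      simp only [Finset.mem_filter, Finset.mem_univ, true_and, Sym2.mem_iff, Finset.mem_union,
        Finset.mem_image, Finset.mem_erase, Sym2.eq_iff]
      constructor
      · intro h
        by_cases ha : v = a
        · exact Or.inl ⟨b, Or.inl ⟨ha, rfl⟩⟩
        by_cases hb : v = b
        · exact Or.inl ⟨a, Or.inr ⟨hb, rfl⟩⟩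
        right
        rcases h with (h | h) | h | h
        · exact absurd h ha
        · exact absurd h hb
        · exact ⟨b, ⟨Ne.symm hb, trivial⟩, Or.inl ⟨h, rfl⟩⟩
        · exact ⟨a, ⟨Ne.symm ha, trivial⟩, Or.inr ⟨h, rfl⟩⟩
      · rintro (⟨u, h | h⟩ | ⟨u, -, h | h⟩) <;> simp [h.1]
  rw [← Finset.prod_filter_mul_prod_filter_not Finset.univ (fun e => v ∈ e ∨ w ∈ e), mul_comm, h₁,
    Finset.prod_union, Finset.prod_image, Finset.prod_image]
  · intro a _ b _ h
    exact Sym2.congr_right.1 h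
  · intro a _ b _ h
    exact Sym2.congr_right.1 h
  · rw [Finset.disjoint_left]
    intro e he he'
    simp only [Finset.mem_image, Finset.mem_erase, Finset.mem_univ] at he he'
    obtain ⟨a, _, rfl⟩ := he
    obtain ⟨b, hb, h⟩ := he'
    simp only [Sym2.eq_iff] at h
    grind

/-! ### Good vertices and the exchange of their labels -/

/-- All pairs formed by `v` and a vertex of `H` are neutral. -/
def InnerGood {n : ℕ} (N : Finset (Bool × Bool)) (H : Finset (Fin n))
    (x : Sym2 (Fin n) → Bool × Bool) (v : Fin n) : Prop :=
  ∀ u ∈ H, x s(v, u) ∈ N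

/-- All pairs formed by `v` and a vertex outside `H` are marked or neutral, and exactly `k` are
marked in each community. -/
def OuterGood {n : ℕ} (M N : Finset (Bool × Bool)) (H : Finset (Fin n)) (k : ℕ) (σ : Labeling n)
    (x : Sym2 (Fin n) → Bool × Bool) (v : Fin n) : Prop :=
  (∀ u ∉ H, x s(v, u) ∈ M ∪ N) ∧
    ∀ c : ℤˣ, ({u | u ∉ H ∧ σ u = c ∧ x s(v, u) ∈ M} : Finset (Fin n)).card = k

section Swap

variable {n : ℕ} {M N : Finset (Bool × Bool)} {H : Finset (Fin n)} {k : ℕ} {σ : Labeling n}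
  {x : Sym2 (Fin n) → Bool × Bool} {v w : Fin n}

lemma prod_marked (hMN : Disjoint M N) (hin : InnerGood N H x v) (hout : OuterGood M N H k σ x v)
    (g : ℤˣ → ℝ) : ∏ u, (if x s(v, u) ∈ M then g (σ u) else 1) = g 1 ^ k * g (-1) ^ k := by
  rw [← Finset.prod_filter]
  have hsplit : ({u | x s(v, u) ∈ M} : Finset (Fin n)) =
      ({u | u ∉ H ∧ σ u = 1 ∧ x s(v, u) ∈ M} : Finset (Fin n)) ∪
        ({u | u ∉ H ∧ σ u = -1 ∧ x s(v, u) ∈ M} : Finset (Fin n)) := by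
    ext u
    have hu : x s(v, u) ∈ M → u ∉ H := fun h hH => Finset.disjoint_left.1 hMN h (hin u hH)
    rcases Int.units_eq_one_or (σ u) with h | h <;> simp [h] <;> tauto
  rw [hsplit, Finset.prod_union]
  · rw [Finset.prod_congr rfl (g := fun _ => g 1) (fun u hu => by
        rw [(Finset.mem_filter.1 hu).2.2.1]), Finset.prod_const, hout.2,
      Finset.prod_congr rfl (g := fun _ => g (-1)) (fun u hu => by
        rw [(Finset.mem_filter.1 hu).2.2.1]), Finset.prod_const, hout.2]
  · rw [Finset.disjoint_left]
    intro u h h'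
    have h₁ := (Finset.mem_filter.1 h).2.2.1
    rw [(Finset.mem_filter.1 h').2.2.1] at h₁
    exact absurd h₁ (by decide)

/-- The balance condition at work: with `k` marked pairs in each community, `p` and `q` are used
equally often, so the label `c` of the vertex drops out. -/
lemma prod_marked_edgeProb (hMN : Disjoint M N) (hin : InnerGood N H x v)
    (hout : OuterGood M N H k σ x v) (p q : unitInterval) (φ : unitInterval → ℝ) (c : ℤˣ) :
    ∏ u, (if x s(v, u) ∈ M then φ (if c = σ u then p else q) else 1) = φ p ^ k * φ q ^ k := by
  rw [prod_marked hMN hin hout (fun d => φ (if c = d then p else q))]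
  rcases Int.units_eq_one_or c with rfl | rfl
  · simp
  · simp [mul_comm]

lemma edgeProb_mk (p q : unitInterval) (σ : Labeling n) (a b : Fin n) :
    edgeProb p q σ s(a, b) = if σ a = σ b then p else q := by
  simp [edgeProb]

/-- Exchanging the labels of two good vertices of `H` does not change a product over the marked
pairs of weights that depend only on the edge probability. -/
lemma prod_marked_swap (hMN : Disjoint M N) (hvw : v ≠ w) (hv : v ∈ H) (hw : w ∈ H)
    (hvin : InnerGood N H x v) (hwin : InnerGood N H x w)
    (hvout : OuterGood M N H k σ x v) (hwout : OuterGood M N H k σ x w)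
    (p q : unitInterval) (φ : unitInterval → Prop → ℝ)
    (z : Sym2 (Fin n) → Prop) [DecidablePred z]
    (hzv : ∀ u, z s(v, u) ↔ x s(v, u) ∈ M) (hzw : ∀ u, z s(w, u) ↔ x s(w, u) ∈ M) :
    ∏ e, (if z e then φ (edgeProb p q (σ ∘ Equiv.swap v w) e) e.IsDiag else 1) =
      ∏ e, (if z e then φ (edgeProb p q σ e) e.IsDiag else 1) := by
  -- Stated for every labeling that agrees with `σ` outside `H`, so that it applies both before and
  -- after the exchange: marked partners of a good vertex all lie outside `H`.
  have row : ∀ {a : Fin n}, a ∈ H → InnerGood N H x a → OuterGood M N H k σ x a →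
      (∀ u, z s(a, u) ↔ x s(a, u) ∈ M) → ∀ σ' : Labeling n, (∀ u ∉ H, σ' u = σ u) →
      ∏ u, (if z s(a, u) then φ (edgeProb p q σ' s(a, u)) s(a, u).IsDiag else 1) =
        φ p False ^ k * φ q False ^ k := by
    intro a ha hin hout hz σ' hσ'
    rw [← prod_marked_edgeProb hMN hin hout p q (fun r => φ r False) (σ' a)]
    refine Finset.prod_congr rfl fun u _ => ?_
    by_cases h : x s(a, u) ∈ M
    · have hu : u ∉ H := fun hH => Finset.disjoint_left.1 hMN h (hin u hH)
      have hau : ¬ a = u := fun h => hu (h ▸ ha)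
      rw [if_pos ((hz u).2 h), if_pos h, edgeProb_mk, hσ' u hu]
      simp [hau]
    · rw [if_neg (mt (hz u).1 h), if_neg h]
  -- The pair of `v` and `w` was already counted in the row of `v`; restoring it to the row of `w`
  -- is harmless, since it lies inside `H` and is therefore unmarked.
  have herase : ∀ σ' : Labeling n,
      ∏ u ∈ Finset.univ.erase v,
        (if z s(w, u) then φ (edgeProb p q σ' s(w, u)) s(w, u).IsDiag else 1) =
      ∏ u, (if z s(w, u) then φ (edgeProb p q σ' s(w, u)) s(w, u).IsDiag else 1) := by
    intro σ'
    apply Finset.prod_erase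
    rw [if_neg]
    rw [hzw]
    exact fun h => Finset.disjoint_left.1 hMN h (hwin v hv)
  have hσ' : ∀ u ∉ H, (σ ∘ Equiv.swap v w) u = σ u := by
    intro u hu
    rw [Function.comp, Equiv.swap_apply_of_ne_of_ne]
    · exact fun h => hu (h ▸ hv)
    · exact fun h => hu (h ▸ hw)
  rw [prod_sym2_split hvw, prod_sym2_split hvw, herase, herase,
    row hv hvin hvout hzv _ hσ', row hw hwin hwout hzw _ hσ',
    row hv hvin hvout hzv _ (fun _ _ => rfl), row hw hwin hwout hzw _ (fun _ _ => rfl)]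
  congr 1
  refine Finset.prod_congr rfl fun e he => ?_
  simp only [Finset.mem_filter, Finset.mem_univ, true_and, not_or] at he
  rw [edgeProb_comp, map_swap_of_notMem he.1 he.2]

lemma prod_map_perm {V : Type*} [Fintype V] [DecidableEq V] (τ : Equiv.Perm V) (f : Sym2 V → ℝ) :
    ∏ e : Sym2 V, f (e.map τ) = ∏ e, f e :=
  (Finite.injective_iff_bijective.1 (Sym2.map.injective τ.injective)).prod_comp f

end Swap

/-! ### The two likelihood comparisons -/

section Likelihood

/-- The probability that a pair is an edge of neither of the two subsampled graphs. -/
noncomputable def noneWeight (r t : ℝ) : ℝ := 1 - r * (2 * t - t ^ 2)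

lemma noneWeight_pos {r t : ℝ} (hr : 0 ≤ r) (hr' : r < 1) : 0 < noneWeight r t := by
  unfold noneWeight
  nlinarith [mul_nonneg hr (sq_nonneg (1 - t))]

/-- The types of pairs that are an edge of at least one graph. -/
abbrev unionMarked : Finset (Bool × Bool) := {(true, true), (true, false), (false, true)}

/-- The type of pairs that are an edge of neither graph. -/
abbrev unionNeutral : Finset (Bool × Bool) := {(false, false)}

/-- The type of pairs that are an edge of the first graph only. -/
abbrev firstMarked : Finset (Bool × Bool) := {(true, false)}

/-- The types of pairs that are not an edge of the first graph. -/
abbrev firstNeutral : Finset (Bool × Bool) := {(false, false), (false, true)}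

/-- The part of `pairWeight` that does not depend on the edge probability. -/
noncomputable def sampleWeight (t : ℝ) : Bool × Bool → ℝ
  | (true, true) => t ^ 2
  | (true, false) => t * (1 - t)
  | (false, true) => t * (1 - t)
  | (false, false) => 1

lemma pairWeight_eq_union {r t : ℝ} (h : noneWeight r t ≠ 0) (y : Bool × Bool) :
    pairWeight r t y = noneWeight r t *
      (if y ∈ unionMarked then r / noneWeight r t else 1) * sampleWeight t y := by
  rcases y with ⟨_ | _, _ | _⟩ <;> simp [pairWeight, sampleWeight] <;>
    first | rfl | (field_simp; simp)

/-- The factor by which an edge common to both graphs is more likely than predicted by the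
weights of the edges of exactly one graph. -/
noncomputable def commonRatio (r t : ℝ) : ℝ := noneWeight r t / (r * (1 - t) ^ 2)

lemma one_le_commonRatio {r t : ℝ} (hr : 0 < r) (hr' : r < 1) (ht : t < 1) :
    1 ≤ commonRatio r t := by
  have : 0 < 1 - t := by linarith
  unfold commonRatio noneWeight
  rw [le_div_iff₀ (by positivity)]
  nlinarith

/-- The weight splits into a factor for each graph and a correction for common edges. The move
treats the three separately: balance handles the first graph, reindexing handles the second, and the
correction can only grow. -/
lemma pairWeight_eq_first {r t : ℝ} (hr : 0 < r) (hr' : r < 1) (ht : t < 1) (y : Bool × Bool) :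
    pairWeight r t y = noneWeight r t *
      (if y.1 = true then r * (t * (1 - t)) / noneWeight r t else 1) *
      (if y.2 = true then r * (t * (1 - t)) / noneWeight r t else 1) *
      (if y.1 = true ∧ y.2 = true then commonRatio r t else 1) := by
  have h : noneWeight r t ≠ 0 := (noneWeight_pos hr.le hr').ne'
  have ht' : 1 - t ≠ 0 := by linarith
  rcases y with ⟨_ | _, _ | _⟩ <;> simp [pairWeight, commonRatio] <;>
    first | rfl | field_simp

variable {n : ℕ} {H : Finset (Fin n)} {k : ℕ} {σ : Labeling n}
  {x : Sym2 (Fin n) → Bool × Bool} {v w : Fin n}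

lemma keepProb_map (s : unitInterval) (τ : Equiv.Perm (Fin n)) (e : Sym2 (Fin n)) :
    keepProb s (e.map τ).IsDiag = keepProb s e.IsDiag := by
  rw [isDiag_map_perm]

/-- This background factor depends only on the labels, and relabelling by a permutation merely
reorders the pairs. -/
lemma prod_noneWeight_comp (p q s : unitInterval) (σ : Labeling n) (τ : Equiv.Perm (Fin n)) :
    ∏ e : Sym2 (Fin n), noneWeight (edgeProb p q (σ ∘ τ) e) (keepProb s e.IsDiag) =
      ∏ e : Sym2 (Fin n), noneWeight (edgeProb p q σ e) (keepProb s e.IsDiag) := by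
  rw [← prod_map_perm τ fun e => noneWeight (edgeProb p q σ e) (keepProb s e.IsDiag)]
  simp only [edgeProb_comp, keepProb_map]

lemma edgeProb_lt_one {p q : unitInterval} (hp : (p : ℝ) < 1) (hq : (q : ℝ) < 1)
    (σ : Labeling n) (e : Sym2 (Fin n)) : (edgeProb p q σ e : ℝ) < 1 := by
  unfold edgeProb
  split_ifs <;> assumption

lemma edgeProb_pos {p q : unitInterval} (hp : 0 < (p : ℝ)) (hq : 0 < (q : ℝ))
    (σ : Labeling n) (e : Sym2 (Fin n)) : 0 < (edgeProb p q σ e : ℝ) := by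
  unfold edgeProb
  split_ifs <;> assumption

/-- Exchanging the labels of two vertices that are balanced in the union graph does not change the
likelihood of the pair of graphs. -/
lemma edgeLaw_swap_union {p q : unitInterval} (hp : (p : ℝ) < 1) (hq : (q : ℝ) < 1)
    (s : unitInterval) (hvw : v ≠ w) (hv : v ∈ H) (hw : w ∈ H)
    (hvin : InnerGood unionNeutral H x v) (hwin : InnerGood unionNeutral H x w)
    (hvout : OuterGood unionMarked unionNeutral H k σ x v)
    (hwout : OuterGood unionMarked unionNeutral H k σ x w) :
    edgeLaw p q s σ x = edgeLaw p q s (σ ∘ Equiv.swap v w) x := by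
  have h : ∀ σ' : Labeling n, ∀ e, noneWeight (edgeProb p q σ' e) (keepProb s e.IsDiag) ≠ 0 :=
    fun σ' e => (noneWeight_pos (edgeProb p q σ' e).2.1 (edgeProb_lt_one hp hq σ' e)).ne'
  rw [edgeLaw_apply, edgeLaw_apply]
  simp only [pairWeight_eq_union (h _ _), Finset.prod_mul_distrib]
  rw [prod_noneWeight_comp, prod_marked_swap (by decide) hvw hv hw hvin hwin hvout hwout p q
    (fun r d => (r : ℝ) / noneWeight r (keepProb s d)) (fun e => x e ∈ unionMarked)
    (fun _ => Iff.rfl) (fun _ => Iff.rfl)]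

/-- Exchanging the labels of two vertices that are isolated in the intersection graph and balanced
in the first graph, together with their neighborhoods in the second graph, does not decrease the
likelihood of the pair of graphs. -/
lemma edgeLaw_le_swap_first {p q s : unitInterval} (hp : (p : ℝ) < 1) (hq : (q : ℝ) < 1)
    (hp₀ : 0 < (p : ℝ)) (hq₀ : 0 < (q : ℝ)) (hs : (s : ℝ) < 1)
    (hvw : v ≠ w) (hv : v ∈ H) (hw : w ∈ H)
    (hvin : InnerGood firstNeutral H x v) (hwin : InnerGood firstNeutral H x w)
    (hvout : OuterGood firstMarked firstNeutral H k σ x v)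
    (hwout : OuterGood firstMarked firstNeutral H k σ x w) :
    edgeLaw p q s σ x ≤ edgeLaw p q s (σ ∘ Equiv.swap v w)
      (fun e => ((x e).1, (x (e.map (Equiv.swap v w))).2)) := by
  have h1 : ∀ (σ' : Labeling n) (e : Sym2 (Fin n)), (edgeProb p q σ' e : ℝ) < 1 :=
    edgeProb_lt_one hp hq
  have h0 : ∀ (σ' : Labeling n) (e : Sym2 (Fin n)), 0 < (edgeProb p q σ' e : ℝ) :=
    edgeProb_pos hp₀ hq₀
  have ht : ∀ e : Sym2 (Fin n), (keepProb s e.IsDiag : ℝ) < 1 := by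
    intro e
    unfold keepProb
    split_ifs
    · simp
    · exact hs
  have hrow : ∀ {a : Fin n}, InnerGood firstNeutral H x a →
      OuterGood firstMarked firstNeutral H k σ x a →
      ∀ u, ((x s(a, u)).1 = true ↔ x s(a, u) ∈ firstMarked) ∧
        ¬ ((x s(a, u)).1 = true ∧ (x s(a, u)).2 = true) := by
    intro a hin hout u
    have : x s(a, u) ∈ firstMarked ∪ firstNeutral := by
      by_cases hu : u ∈ H
      · exact Finset.mem_union_right _ (hin u hu)
      · exact hout.1 u hu
    generalize x s(a, u) = y at this
    revert this
    revert y
    decide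
  rw [edgeLaw_apply, edgeLaw_apply]
  apply ENNReal.ofReal_le_ofReal
  simp only [pairWeight_eq_first (h0 _ _) (h1 _ _) (ht _), Finset.prod_mul_distrib]
  rw [prod_noneWeight_comp, prod_marked_swap (by decide) hvw hv hw hvin hwin hvout hwout p q
    (fun r d => (r : ℝ) * ((keepProb s d : ℝ) * (1 - keepProb s d)) / noneWeight r (keepProb s d))
    (fun e => (x e).1 = true) (fun u => (hrow hvin hvout u).1) (fun u => (hrow hwin hwout u).1)]
  -- The second graph is transposed along with the labels, so its factor is only reindexed; no
  -- balance is needed there.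
  have hsecond : ∏ e : Sym2 (Fin n), (if (x (e.map (Equiv.swap v w))).2 = true then
        (edgeProb p q (σ ∘ Equiv.swap v w) e : ℝ) *
          ((keepProb s e.IsDiag : ℝ) * (1 - keepProb s e.IsDiag)) /
          noneWeight (edgeProb p q (σ ∘ Equiv.swap v w) e) (keepProb s e.IsDiag) else 1) =
      ∏ e : Sym2 (Fin n), (if (x e).2 = true then (edgeProb p q σ e : ℝ) *
          ((keepProb s e.IsDiag : ℝ) * (1 - keepProb s e.IsDiag)) /
          noneWeight (edgeProb p q σ e) (keepProb s e.IsDiag) else 1) := by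
    rw [← prod_map_perm (Equiv.swap v w) (fun e => (if (x e).2 = true then
          (edgeProb p q σ e : ℝ) * ((keepProb s e.IsDiag : ℝ) * (1 - keepProb s e.IsDiag)) /
          noneWeight (edgeProb p q σ e) (keepProb s e.IsDiag) else 1))]
    simp only [edgeProb_comp, keepProb_map]
  rw [hsecond]
  have hfac : ∀ e : Sym2 (Fin n), 0 ≤ (edgeProb p q σ e : ℝ) *
      ((keepProb s e.IsDiag : ℝ) * (1 - keepProb s e.IsDiag)) /
        noneWeight (edgeProb p q σ e) (keepProb s e.IsDiag) := by
    intro e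
    have := (noneWeight_pos (t := keepProb s e.IsDiag) (h0 σ e).le (h1 σ e)).le
    have := sub_nonneg.2 (ht e).le
    have := (h0 σ e).le
    have := (keepProb s e.IsDiag).2.1
    positivity
  refine mul_le_mul_of_nonneg_left (Finset.prod_le_prod ?_ ?_) (mul_nonneg (mul_nonneg
    (Finset.prod_nonneg fun e _ => (noneWeight_pos (h0 σ e).le (h1 σ e)).le)
    (Finset.prod_nonneg fun e _ => ?_)) (Finset.prod_nonneg fun e _ => ?_))
  · intro e _
    split_ifs
    · exact zero_le_one.trans (one_le_commonRatio (h0 σ e) (h1 σ e) (ht e))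
    · exact zero_le_one
  · intro e _
    -- At `v` and `w` there is no common edge before the move, so the old factor is 1, while a
    -- common edge created by the move contributes at least 1. Other pairs are untouched.
    by_cases he : v ∈ e ∨ w ∈ e
    · have hnot : ¬ ((x e).1 = true ∧ (x e).2 = true) := by
        rcases he with he | he
        · obtain ⟨u, rfl⟩ := Sym2.mem_iff_exists.1 he
          exact (hrow hvin hvout u).2
        · obtain ⟨u, rfl⟩ := Sym2.mem_iff_exists.1 he
          exact (hrow hwin hwout u).2
      rw [if_neg hnot]
      split_ifs
      · exact one_le_commonRatio (h0 _ e) (h1 _ e) (ht e)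
      · exact le_rfl
    · rw [not_or] at he
      rw [edgeProb_comp, map_swap_of_notMem he.1 he.2]
  · split_ifs
    · exact hfac e
    · exact zero_le_one
  · split_ifs
    · exact hfac e
    · exact zero_le_one

/-- Exchange labels, keeping the graphs and the permutation. -/
def unionMove (τ : Equiv.Perm (Fin n)) (z : Config n) : Config n := (z.1 ∘ τ, z.2.1, z.2.2)

/-- Exchange labels and the roles of the vertices in the second graph. -/
def firstMove (τ : Equiv.Perm (Fin n)) (z : Config n) : Config n :=
  (z.1 ∘ τ, fun e => ((z.2.1 e).1, (z.2.1 (e.map τ)).2), z.2.2 * τ)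

lemma unionMove_unionMove (v w : Fin n) (z : Config n) :
    unionMove (Equiv.swap v w) (unionMove (Equiv.swap v w) z) = z := by
  obtain ⟨σ, x, π⟩ := z
  simp only [unionMove, Prod.mk.injEq, and_true]
  funext u
  simp

lemma firstMove_firstMove (v w : Fin n) (z : Config n) :
    firstMove (Equiv.swap v w) (firstMove (Equiv.swap v w) z) = z := by
  obtain ⟨σ, x, π⟩ := z
  simp only [firstMove, Prod.mk.injEq]
  refine ⟨?_, ?_, ?_⟩
  · funext u
    simp
  · funext e
    have : (Equiv.swap v w : Fin n → Fin n) ∘ Equiv.swap v w = id := by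
      funext u
      simp
    rw [Sym2.map_map, this, Sym2.map_id, id]
  · rw [mul_assoc, Equiv.swap_mul_self, mul_one]

lemma firstMove_G₂ (v w : Fin n) (z : Config n) :
    (firstMove (Equiv.swap v w) z).toOutcome.G₂ = z.toOutcome.G₂ := by
  obtain ⟨σ, x, π⟩ := z
  simp only [firstMove, Config.toOutcome, Equiv.Perm.coe_mul]
  rw [← SimpleGraph.map_map]
  congr 1
  ext a b
  simp only [SimpleGraph.map_adj', SimpleGraph.fromEdgeSet_adj, Set.mem_ofPred_eq, Sym2.map_mk]
  constructor
  · rintro ⟨hab, a', b', ⟨h, -⟩, rfl, rfl⟩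
    exact ⟨h, hab⟩
  · rintro ⟨h, hab⟩
    exact ⟨hab, Equiv.swap v w a, Equiv.swap v w b, ⟨by simpa using h, by simpa using hab⟩,
      by simp, by simp⟩

lemma uniform_labels_apply (σ : Labeling n) :
    (indep fun _ : Fin n => PMF.uniformOfFintype ℤˣ) σ = 2⁻¹ ^ n := by
  simp [indep_apply]

end Likelihood

/-! ### Independence and binomial bounds for product measures -/

open MeasureTheory ProbabilityTheory

section Product

lemma dependsOn_inter {ι κ : Type} {A B : Set (ι → κ)} {S : Set ι} (hA : DependsOn (· ∈ A) S)
    (hB : DependsOn (· ∈ B) S) : DependsOn (· ∈ A ∩ B) S := by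
  intro x y h
  have h₁ := hA h
  have h₂ := hB h
  simp only at h₁ h₂
  simp [h₁, h₂]

lemma dependsOn_compl {ι κ : Type} {A : Set (ι → κ)} {S : Set ι} (hA : DependsOn (· ∈ A) S) :
    DependsOn (· ∈ Aᶜ) S := by
  intro x y h
  have h₁ := hA h
  simp only at h₁
  simp [h₁]

variable {ι κ V : Type} [Fintype ι] [Fintype κ] [MeasurableSpace κ]
  [MeasurableSingletonClass κ]

lemma toMeasure_indep [DecidableEq ι] (P : ι → PMF κ) :
    (indep P).toMeasure = Measure.pi fun i => (P i).toMeasure := by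
  refine Measure.ext_of_singleton fun x => ?_
  rw [PMF.toMeasure_apply_singleton _ _ (measurableSet_singleton x), Measure.pi_singleton]
  rw [indep_apply]
  exact Finset.prod_congr rfl fun i _ =>
    (PMF.toMeasure_apply_singleton _ _ (measurableSet_singleton _)).symm

variable (ν : ι → Measure κ) [∀ i, IsProbabilityMeasure (ν i)]

lemma measure_pi_inter {A B : Set (ι → κ)} {S T : Finset ι} (hST : Disjoint S T)
    (hA : DependsOn (· ∈ A) (S : Set ι)) (hB : DependsOn (· ∈ B) (T : Set ι)) :
    Measure.pi ν (A ∩ B) = Measure.pi ν A * Measure.pi ν B := by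
  have hind := (iIndepFun_pi (μ := ν) (X := fun _ => id) fun _ => aemeasurable_id).indepFun_finset
    S T hST fun i => measurable_pi_apply i
  have key : ∀ {A : Set (ι → κ)} {S : Finset ι}, DependsOn (· ∈ A) (S : Set ι) →
      -- An event that depends only on `S` is the preimage of its own restriction to `S`.
      A = (fun (x : ι → κ) (i : S) => id (x i)) ⁻¹'
        ((fun (x : ι → κ) (i : S) => id (x i)) '' A) := by
    intro A S hA
    refine Set.Subset.antisymm (Set.subset_preimage_image _ _) ?_
    rintro x ⟨y, hy, hyx⟩
    have h := hA (x := y) (y := x) fun i hi => congrFun hyx ⟨i, hi⟩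
    exact h.mp hy
  rw [key hA, key hB]
  exact hind.measure_inter_preimage_eq_mul _ _ (Set.toFinite _).measurableSet
    (Set.toFinite _).measurableSet

/-- Independent events of probability at least `c` all fail with probability at most
`(1 - c) ^ B.card`. -/
lemma measure_forall_notMem_le [DecidableEq ι] [DecidableEq V] (B : Finset V) (E : V → Set (ι → κ))
    (S : V → Finset ι) (hS : (B : Set V).PairwiseDisjoint S)
    (hE : ∀ v ∈ B, DependsOn (· ∈ E v) (S v : Set ι)) (c : ENNReal)
    (hc : ∀ v ∈ B, c ≤ Measure.pi ν (E v)) :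
    Measure.pi ν {x | ∀ v ∈ B, x ∉ E v} ≤ (1 - c) ^ B.card := by
  induction B using Finset.induction_on with
  | empty => simp
  | insert a B ha ih =>
    have hset : {x | ∀ v ∈ insert a B, x ∉ E v} = (E a)ᶜ ∩ {x | ∀ v ∈ B, x ∉ E v} := by
      ext x
      simp
    have hdep : DependsOn (· ∈ {x | ∀ v ∈ B, x ∉ E v}) ((B.biUnion S : Finset ι) : Set ι) := by
      intro x y h
      refine propext (forall₂_congr fun v hv => not_congr (iff_of_eq ?_))
      exact hE v (Finset.mem_insert_of_mem hv) fun i hi =>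
        h i (Finset.mem_coe.2 (Finset.mem_biUnion.2 ⟨v, hv, hi⟩))
    have hdisj : Disjoint (S a) (B.biUnion S) := by
      rw [Finset.disjoint_biUnion_right]
      intro v hv
      exact hS (by simp) (by simp [hv]) fun h => ha (h ▸ hv)
    rw [hset, measure_pi_inter ν hdisj (dependsOn_compl (hE a (by simp))) hdep,
      Finset.card_insert_of_notMem ha, pow_succ, mul_comm]
    refine mul_le_mul' (ih (hS.subset (by simp)) (fun v hv => hE v (by simp [hv]))
      fun v hv => hc v (by simp [hv])) ?_
    rw [prob_compl_eq_one_sub (Set.toFinite _).measurableSet]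
    exact tsub_le_tsub_left (hc a (by simp)) _

/-- If the events `F v` are likely and independent of the family `E`, then some `E v ∩ F v` is
almost as likely to occur as some `E v`. -/
lemma measure_forall_not_and_le [DecidableEq V] (B : Finset V) (E F : V → Set (ι → κ))
    (S T : Finset ι) (hST : Disjoint S T)
    (hE : ∀ v ∈ B, DependsOn (· ∈ E v) (S : Set ι))
    (hF : ∀ v ∈ B, DependsOn (· ∈ F v) (T : Set ι)) (ε : ENNReal)
    (hε : ∀ v ∈ B, Measure.pi ν (F v)ᶜ ≤ ε) (C : Set (ι → κ))
    (hC : DependsOn (· ∈ C) (S : Set ι)) :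
    Measure.pi ν (C ∩ {x | ∀ v ∈ B, ¬ (x ∈ E v ∧ x ∈ F v)}) ≤
      Measure.pi ν (C ∩ {x | ∀ v ∈ B, x ∉ E v}) + ε * Measure.pi ν C := by
  -- `C` carries the failure of `E` at the vertices already treated. The events "first success of
  -- `E` at `a`" are disjoint, so the error `ε` is paid once in total and not once per vertex.
  induction B using Finset.induction_on generalizing C with
  | empty => simp
  | insert a B ha ih =>
    have hEa := hE a (by simp)
    have hsub : C ∩ {x | ∀ v ∈ insert a B, ¬ (x ∈ E v ∧ x ∈ F v)} ⊆
        ((C ∩ E a) ∩ (F a)ᶜ) ∪ ((C ∩ (E a)ᶜ) ∩ {x | ∀ v ∈ B, ¬ (x ∈ E v ∧ x ∈ F v)}) := by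
      rintro x ⟨hx, h⟩
      by_cases hxa : x ∈ E a
      · exact Or.inl ⟨⟨hx, hxa⟩, fun hf => h a (by simp) ⟨hxa, hf⟩⟩
      · exact Or.inr ⟨⟨hx, hxa⟩, fun v hv => h v (by simp [hv])⟩
    have hset : C ∩ {x | ∀ v ∈ insert a B, x ∉ E v} =
        (C ∩ (E a)ᶜ) ∩ {x | ∀ v ∈ B, x ∉ E v} := by
      ext x
      simp [and_assoc]
    refine (measure_mono hsub).trans ((measure_union_le _ _).trans ?_)
    rw [measure_pi_inter ν hST (dependsOn_inter hC hEa) (dependsOn_compl (hF a (by simp))), hset]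
    have h₁ := ih (fun v hv => hE v (by simp [hv])) (fun v hv => hF v (by simp [hv]))
      (fun v hv => hε v (by simp [hv])) (C ∩ (E a)ᶜ) (dependsOn_inter hC (dependsOn_compl hEa))
    have h₂ : Measure.pi ν (C ∩ E a) * Measure.pi ν (F a)ᶜ ≤ ε * Measure.pi ν (C ∩ E a) := by
      rw [mul_comm]
      exact mul_le_mul_left (hε a (by simp)) _
    have h₃ : Measure.pi ν C = Measure.pi ν (C ∩ E a) + Measure.pi ν (C ∩ (E a)ᶜ) := by
      rw [← Set.sdiff_eq]
      exact (measure_inter_add_sdiff _ (Set.toFinite _).measurableSet).symm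
    calc _ ≤ ε * Measure.pi ν (C ∩ E a) + (Measure.pi ν ((C ∩ (E a)ᶜ) ∩ {x | ∀ v ∈ B, x ∉ E v}) +
          ε * Measure.pi ν (C ∩ (E a)ᶜ)) := add_le_add h₂ h₁
      _ = _ := by rw [h₃]; ring

/-- The probability that exactly `k` coordinates in `S` are in `M` and the others in `N`. -/
lemma binomial_le_measure_pi [DecidableEq ι] [DecidableEq κ] {M N : Finset κ} (hMN : Disjoint M N) (S : Finset ι)
    (k : ℕ) (m m' : ENNReal) (hm : ∀ i ∈ S, ν i M = m) (hm' : ∀ i ∈ S, ν i N = m') :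
    (S.card.choose k : ENNReal) * m ^ k * m' ^ (S.card - k) ≤
      Measure.pi ν {x | (∀ i ∈ S, x i ∈ M ∪ N) ∧ (S.filter fun i => x i ∈ M).card = k} := by
  -- The box on which `A` is exactly the marked set. Boxes of different `A` are disjoint, and those
  -- with `k` marked points have equal mass.
  let box : Finset ι → Set (ι → κ) := fun A =>
    Set.univ.pi fun i => if i ∈ A then (M : Set κ) else if i ∈ S then (N : Set κ) else Set.univ
  have hbox : ∀ A ∈ S.powersetCard k, ∀ x ∈ box A,
      (∀ i ∈ S, x i ∈ M ∪ N) ∧ (S.filter fun i => x i ∈ M) = A := by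
    intro A hA x hx
    have hAS := (Finset.mem_powersetCard.1 hA).1
    have hx' : ∀ i ∈ S, (i ∈ A → x i ∈ M) ∧ (i ∉ A → x i ∈ N) := by
      intro i hi
      have := hx i (Set.mem_univ i)
      constructor <;> intro h <;> simpa [h, hi] using this
    refine ⟨fun i hi => ?_, ?_⟩
    · by_cases h : i ∈ A
      · exact Finset.mem_union_left _ ((hx' i hi).1 h)
      · exact Finset.mem_union_right _ ((hx' i hi).2 h)
    · ext i
      rw [Finset.mem_filter]
      constructor
      · rintro ⟨hi, h⟩
        by_contra hA'
        exact Finset.disjoint_left.1 hMN h ((hx' i hi).2 hA')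
      · exact fun h => ⟨hAS h, (hx' i (hAS h)).1 h⟩
  have hmeas : ∀ A ∈ S.powersetCard k, Measure.pi ν (box A) = m ^ k * m' ^ (S.card - k) := by
    intro A hA
    obtain ⟨hAS, hAk⟩ := Finset.mem_powersetCard.1 hA
    rw [Measure.pi_pi]
    have h₁ : ∀ i, ν i (if i ∈ A then (M : Set κ) else if i ∈ S then (N : Set κ) else Set.univ) =
        (if i ∈ A then m else 1) * (if i ∈ S \ A then m' else 1) := by
      intro i
      by_cases hiA : i ∈ A
      · simp [hiA, hm i (hAS hiA)]
      · by_cases hiS : i ∈ S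
        · simp [hiA, hiS, hm' i hiS]
        · simp [hiA, hiS]
    simp only [h₁, Finset.prod_mul_distrib, Finset.prod_ite_mem, Finset.univ_inter,
      Finset.prod_const, hAk, Finset.card_sdiff_of_subset hAS]
  have hdisj : (S.powersetCard k : Set (Finset ι)).PairwiseDisjoint box := by
    intro A hA A' hA' hne
    refine Set.disjoint_left.2 fun x hx hx' => hne ?_
    rw [← (hbox A hA x hx).2, (hbox A' hA' x hx').2]
  calc (S.card.choose k : ENNReal) * m ^ k * m' ^ (S.card - k)
      = ∑ A ∈ S.powersetCard k, Measure.pi ν (box A) := by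
        rw [Finset.sum_congr rfl hmeas, Finset.sum_const, Finset.card_powersetCard]
        simp [mul_assoc]
    _ = Measure.pi ν (⋃ A ∈ S.powersetCard k, box A) :=
        (measure_biUnion_finset hdisj fun A _ => (Set.toFinite _).measurableSet).symm
    _ ≤ _ := by
        refine measure_mono (Set.iUnion₂_subset fun A hA x hx => ?_)
        obtain ⟨h₁, h₂⟩ := hbox A hA x hx
        exact ⟨h₁, by rw [h₂]; exact (Finset.mem_powersetCard.1 hA).2⟩

end Product

/-! ### Good vertices in a block, with the labels fixed -/

section Block

variable {n : ℕ}

/-- The pairs formed by `v` and a vertex outside `H`. -/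
def outerPairs (H : Finset (Fin n)) (v : Fin n) : Finset (Sym2 (Fin n)) :=
  Hᶜ.image fun u => s(v, u)

/-- The pairs inside `H`. -/
def innerPairs (H : Finset (Fin n)) : Finset (Sym2 (Fin n)) := {e | ∀ u ∈ e, u ∈ H}

lemma dependsOn_outerGood (M N : Finset (Bool × Bool)) (H : Finset (Fin n)) (k : ℕ)
    (σ : Labeling n) (v : Fin n) :
    DependsOn (· ∈ {x | OuterGood M N H k σ x v}) (outerPairs H v : Set (Sym2 (Fin n))) := by
  intro x y h
  have h' : ∀ u ∉ H, x s(v, u) = y s(v, u) := fun u hu =>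
    h _ (Finset.mem_coe.2 (Finset.mem_image.2 ⟨u, Finset.mem_compl.2 hu, rfl⟩))
  refine propext (and_congr (forall₂_congr fun u hu => by rw [h' u hu])
    (forall_congr' fun c => ?_))
  rw [Finset.filter_congr fun u _ => and_congr_right fun hu => by rw [h' u hu]]

lemma dependsOn_innerGood (N : Finset (Bool × Bool)) (H : Finset (Fin n)) {v : Fin n}
    (hv : v ∈ H) :
    DependsOn (· ∈ {x | InnerGood N H x v}) (innerPairs H : Set (Sym2 (Fin n))) := by
  intro x y h
  refine propext (forall₂_congr fun u hu => ?_)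
  rw [h s(v, u) (by simp [innerPairs, hv, hu])]

/-- The reason for restricting balance to pairs leaving `H`: distinct vertices of the block then
have independent outer conditions. -/
lemma pairwiseDisjoint_outerPairs (H : Finset (Fin n)) :
    (H : Set (Fin n)).PairwiseDisjoint (outerPairs H) := by
  intro v hv w hw hne
  refine Finset.disjoint_left.2 fun e he he' => ?_
  simp only [outerPairs, Finset.mem_image, Finset.mem_compl] at he he'
  obtain ⟨a, ha, rfl⟩ := he
  obtain ⟨b, hb, h⟩ := he'
  rw [Sym2.eq_iff] at h
  rcases h with h | h
  · exact hne h.1.symm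
  · exact ha (h.1 ▸ hw)

lemma disjoint_outerPairs_innerPairs (H : Finset (Fin n)) :
    Disjoint (H.biUnion (outerPairs H)) (innerPairs H) := by
  refine Finset.disjoint_left.2 fun e he he' => ?_
  simp only [outerPairs, Finset.mem_biUnion, Finset.mem_image, Finset.mem_compl] at he
  obtain ⟨v, -, u, hu, rfl⟩ := he
  simp only [innerPairs, Finset.mem_filter] at he'
  exact hu (he'.2 u (by simp))

/-- The vertices outside `H` with label `c`. -/
def outerClass (H : Finset (Fin n)) (σ : Labeling n) (c : ℤˣ) : Finset (Fin n) :=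
  {u | u ∉ H ∧ σ u = c}

lemma le_measure_outerGood (ν : Sym2 (Fin n) → Measure (Bool × Bool))
    [∀ e, IsProbabilityMeasure (ν e)] {M N : Finset (Bool × Bool)} (hMN : Disjoint M N)
    {H : Finset (Fin n)} (k : ℕ) (σ : Labeling n) (v : Fin n) (m m' : ℤˣ → ENNReal)
    (hm : ∀ u ∉ H, ν s(v, u) M = m (σ u)) (hm' : ∀ u ∉ H, ν s(v, u) N = m' (σ u)) :
    ∏ c : ℤˣ, (((outerClass H σ c).card.choose k : ENNReal) * m c ^ k *
      m' c ^ ((outerClass H σ c).card - k)) ≤ Measure.pi ν {x | OuterGood M N H k σ x v} := by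
  let S : ℤˣ → Finset (Sym2 (Fin n)) := fun c => (outerClass H σ c).image fun u => s(v, u)
  have hinj : Function.Injective fun u : Fin n => s(v, u) := fun a b h => Sym2.congr_right.1 h
  have hcard : ∀ c, (S c).card = (outerClass H σ c).card := fun c =>
    Finset.card_image_of_injective _ hinj
  let A : ℤˣ → Set (Sym2 (Fin n) → Bool × Bool) := fun c =>
    {x | (∀ i ∈ S c, x i ∈ M ∪ N) ∧ ((S c).filter fun i => x i ∈ M).card = k}
  have hA : ∀ c, DependsOn (· ∈ A c) (S c : Set (Sym2 (Fin n))) := by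
    intro c x y h
    refine propext (and_congr (forall₂_congr fun i hi => by rw [h i hi]) ?_)
    rw [Finset.filter_congr fun i hi => by rw [h i hi]]
  have hdisj : Disjoint (S 1) (S (-1)) := by
    refine Finset.disjoint_left.2 fun e he he' => ?_
    simp only [S, outerClass, Finset.mem_image, Finset.mem_filter, Finset.mem_univ, true_and]
      at he he'
    obtain ⟨a, ha, rfl⟩ := he
    obtain ⟨b, hb, h⟩ := he'
    obtain rfl := hinj h
    exact absurd (ha.2.symm.trans hb.2) (by decide)
  have hbin : ∀ c, ((outerClass H σ c).card.choose k : ENNReal) * m c ^ k *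
      m' c ^ ((outerClass H σ c).card - k) ≤ Measure.pi ν (A c) := by
    intro c
    rw [← hcard c]
    refine binomial_le_measure_pi ν hMN (S c) k (m c) (m' c) ?_ ?_ <;>
    · intro i hi
      obtain ⟨u, hu, rfl⟩ := Finset.mem_image.1 hi
      simp only [outerClass, Finset.mem_filter, Finset.mem_univ, true_and] at hu
      simp [hm, hm', hu.1, hu.2]
  have huniv : (Finset.univ : Finset ℤˣ) = {1, -1} := by decide
  have hprod : ∀ f : ℤˣ → ENNReal, ∏ c, f c = f 1 * f (-1) := by
    intro f
    rw [huniv, Finset.prod_pair (by decide)]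
  rw [hprod]
  refine (mul_le_mul' (hbin 1) (hbin (-1))).trans ?_
  rw [← measure_pi_inter ν hdisj (hA 1) (hA (-1))]
  refine measure_mono fun x hx => ?_
  have hx' : ∀ c, x ∈ A c := fun c => by
    rcases Int.units_eq_one_or c with rfl | rfl
    exacts [hx.1, hx.2]
  refine ⟨fun u hu => (hx' (σ u)).1 _ (Finset.mem_image_of_mem _ ?_), fun c => ?_⟩
  · simp [outerClass, hu]
  · rw [← (hx' c).2, Finset.filter_image, Finset.card_image_of_injective _ hinj, outerClass,
      Finset.filter_filter]
    simp only [and_assoc]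

/-- With high probability, `H` contains a good vertex with a given label. -/
lemma measure_no_good_le (ν : Sym2 (Fin n) → Measure (Bool × Bool))
    [∀ e, IsProbabilityMeasure (ν e)] {M N : Finset (Bool × Bool)} (H : Finset (Fin n)) (k : ℕ)
    (σ : Labeling n) (d : ℤˣ) (c η : ENNReal)
    (hc : ∀ v ∈ H, σ v = d → c ≤ Measure.pi ν {x | OuterGood M N H k σ x v})
    (hη : ∀ e, ν e ((N : Set (Bool × Bool))ᶜ) ≤ η) :
    Measure.pi ν {x | ¬ ∃ v ∈ H, σ v = d ∧ OuterGood M N H k σ x v ∧ InnerGood N H x v} ≤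
      (1 - c) ^ (H.filter fun v => σ v = d).card + H.card * η := by
  set B := H.filter fun v => σ v = d with hB
  have hBH : ∀ v ∈ B, v ∈ H := fun v hv => (Finset.mem_filter.1 hv).1
  have hF : ∀ v ∈ B, Measure.pi ν {x | InnerGood N H x v}ᶜ ≤ H.card * η := by
    intro v _
    have hsub : {x | InnerGood N H x v}ᶜ ⊆
        ⋃ u ∈ H, (Function.eval s(v, u)) ⁻¹' ((N : Set (Bool × Bool))ᶜ) := by
      intro x hx
      simp only [Set.mem_compl_iff, Set.mem_ofPred_eq, InnerGood, not_forall] at hx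
      obtain ⟨u, hu, h⟩ := hx
      exact Set.mem_iUnion₂.2 ⟨u, hu, by simpa using h⟩
    refine (measure_mono hsub).trans ((measure_biUnion_finset_le _ _).trans ?_)
    refine (Finset.sum_le_card_nsmul _ _ η fun u _ => ?_).trans (by simp)
    rw [(measurePreserving_eval ν s(v, u)).measure_preimage
      (Set.toFinite _).measurableSet.nullMeasurableSet]
    exact hη _
  -- The inner conditions of different vertices share pairs and are not independent of each other,
  -- but together they are independent of all the outer ones.
  have h := measure_forall_not_and_le ν B (fun v => {x | OuterGood M N H k σ x v})
    (fun v => {x | InnerGood N H x v}) (H.biUnion (outerPairs H)) (innerPairs H)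
    (disjoint_outerPairs_innerPairs H)
    (fun v hv => (dependsOn_outerGood M N H k σ v).mono
      (Finset.coe_subset.2 (Finset.subset_biUnion_of_mem _ (hBH v hv))))
    (fun v hv => dependsOn_innerGood N H (hBH v hv)) (H.card * η) hF Set.univ
    (fun x y _ => by simp)
  have h' := measure_forall_notMem_le ν B (fun v => {x | OuterGood M N H k σ x v})
    (outerPairs H) ((pairwiseDisjoint_outerPairs H).subset fun v hv => hBH v hv)
    (fun v _ => dependsOn_outerGood M N H k σ v) c
    (fun v hv => hc v (hBH v hv) (Finset.mem_filter.1 hv).2)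
  simp only [Set.univ_inter, measure_univ, mul_one] at h
  refine le_trans (le_of_eq ?_) (h.trans (add_le_add_left h' _))
  congr 1
  ext x
  simp only [Set.mem_ofPred_eq, hB, Finset.mem_filter, not_exists, not_and]
  exact ⟨fun h v hv => h v hv.1 hv.2, fun h v hv hd => h v ⟨hv, hd⟩⟩

end Block

/-! ### Concentration of the labels and averaging over them -/

section Labels

variable {n : ℕ}

/-- The sum of the labels in `S`. -/
def labelSum (S : Finset (Fin n)) (σ : Labeling n) : ℝ := ∑ i ∈ S, ((σ i : ℤ) : ℝ)

/-- Flipping the label of `i` is a bijection of the labelings that changes the sign of the summand.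
-/
lemma sum_label_mul_label {i j : Fin n} (hij : i ≠ j) :
    ∑ σ : Labeling n, ((σ i : ℤ) : ℝ) * ((σ j : ℤ) : ℝ) = 0 := by
  have h := Equiv.sum_comp (Equiv.mulRight (Pi.mulSingle i (-1) : Labeling n))
    (fun σ : Labeling n => ((σ i : ℤ) : ℝ) * ((σ j : ℤ) : ℝ))
  simp only [Equiv.coe_mulRight, Pi.mul_apply, Pi.mulSingle_eq_same,
    Pi.mulSingle_eq_of_ne hij.symm, mul_one, mul_neg, Units.val_neg, Int.cast_neg, neg_mul,
    Finset.sum_neg_distrib] at h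
  linarith

lemma sum_labelSum_sq (S : Finset (Fin n)) :
    ∑ σ : Labeling n, labelSum S σ ^ 2 = 2 ^ n * S.card := by
  have hsq : ∀ (σ : Labeling n) i, ((σ i : ℤ) : ℝ) * ((σ i : ℤ) : ℝ) = 1 := by
    intro σ i
    rcases Int.units_eq_one_or (σ i) with h | h <;> simp [h]
  have hij : ∀ i j : Fin n, ∑ σ : Labeling n, ((σ i : ℤ) : ℝ) * ((σ j : ℤ) : ℝ) =
      if i = j then 2 ^ n else 0 := by
    intro i j
    split_ifs with h
    · subst h
      simp [hsq]
    · exact sum_label_mul_label h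
  simp only [labelSum, sq, Finset.sum_mul_sum]
  rw [Finset.sum_comm]
  simp_rw [Finset.sum_comm (s := Finset.univ), hij]
  simp [mul_comm]

lemma labelSum_chebyshev {S : Finset (Fin n)} (hS : 0 < S.card) {δ : ℝ} (hδ : 0 < δ) :
    (indep fun _ : Fin n => PMF.uniformOfFintype ℤˣ).toOuterMeasure
      {σ | δ * S.card < |labelSum S σ|} ≤ ENNReal.ofReal (1 / (δ ^ 2 * S.card)) := by
  classical
  have hS' : (0 : ℝ) < S.card := by exact_mod_cast hS
  set A : Finset (Labeling n) := {σ | δ * S.card < |labelSum S σ|} with hA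
  have hcard : (A.card : ℝ) * (δ * S.card) ^ 2 ≤ 2 ^ n * S.card := by
    rw [← sum_labelSum_sq, ← nsmul_eq_mul]
    calc A.card • (δ * (S.card : ℝ)) ^ 2 ≤ ∑ σ ∈ A, labelSum S σ ^ 2 := by
          refine Finset.card_nsmul_le_sum _ _ _ fun σ hσ => ?_
          rw [← sq_abs (labelSum S σ)]
          have := (Finset.mem_filter.1 hσ).2
          gcongr
      _ ≤ _ := Finset.sum_le_sum_of_subset_of_nonneg (Finset.subset_univ _)
          fun _ _ _ => sq_nonneg _
  have hset : {σ : Labeling n | δ * S.card < |labelSum S σ|} = (A : Set (Labeling n)) := by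
    ext σ
    simp [hA]
  rw [hset, PMF.toOuterMeasure_apply_finset]
  simp only [uniform_labels_apply, Finset.sum_const, nsmul_eq_mul]
  have h2 : (2⁻¹ : ENNReal) ^ n = ENNReal.ofReal ((2 : ℝ) ^ n)⁻¹ := by
    rw [ENNReal.ofReal_inv_of_pos (by positivity), ENNReal.ofReal_pow (by norm_num),
      ENNReal.inv_pow]
    simp
  rw [h2, ← ENNReal.ofReal_natCast, ← ENNReal.ofReal_mul (by positivity)]
  apply ENNReal.ofReal_le_ofReal
  rw [le_div_iff₀ (by positivity), ← div_eq_mul_inv, div_mul_eq_mul_div,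
    div_le_one (by positivity)]
  nlinarith

lemma card_label_eq (S : Finset (Fin n)) (σ : Labeling n) (c : ℤˣ) :
    ((S.filter fun v => σ v = c).card : ℝ) = (S.card + ((c : ℤ) : ℝ) * labelSum S σ) / 2 := by
  have : ∀ v, (if σ v = c then (1 : ℝ) else 0) = (1 + ((c : ℤ) : ℝ) * ((σ v : ℤ) : ℝ)) / 2 := by
    intro v
    rcases Int.units_eq_one_or (σ v) with h | h <;>
      rcases Int.units_eq_one_or c with hc | hc <;> rw [h, hc] <;> norm_num
  rw [Finset.card_filter, Nat.cast_sum]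
  simp only [Nat.cast_ite, Nat.cast_one, Nat.cast_zero, this, labelSum]
  rw [← Finset.sum_div, Finset.sum_add_distrib, Finset.mul_sum]
  simp

lemma abs_card_label_sub_le {S : Finset (Fin n)} {σ : Labeling n} {a : ℝ}
    (h : |labelSum S σ| ≤ a) (c : ℤˣ) :
    |((S.filter fun v => σ v = c).card : ℝ) - S.card / 2| ≤ a / 2 := by
  rw [card_label_eq]
  have hc : |((c : ℤ) : ℝ)| = 1 := by
    rcases Int.units_eq_one_or c with rfl | rfl <;> simp
  rw [show (S.card + ((c : ℤ) : ℝ) * labelSum S σ) / 2 - (S.card : ℝ) / 2 =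
    ((c : ℤ) : ℝ) * labelSum S σ / 2 by ring, abs_div, abs_mul, hc]
  norm_num
  linarith

lemma configLaw_toOuterMeasure (p q s : unitInterval)
    (B : Labeling n → Set (Sym2 (Fin n) → Bool × Bool)) :
    (configLaw n p q s).toOuterMeasure {z | z.2.1 ∈ B z.1} =
      ∑ σ, (indep fun _ : Fin n => PMF.uniformOfFintype ℤˣ) σ *
        (edgeLaw p q s σ).toOuterMeasure (B σ) := by
  classical
  unfold configLaw
  rw [PMF.toOuterMeasure_bind_apply, tsum_fintype]
  refine Finset.sum_congr rfl fun σ _ => ?_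
  rw [PMF.toOuterMeasure_bind_apply, PMF.toOuterMeasure_apply]
  congr 1
  refine tsum_congr fun x => ?_
  rw [PMF.toOuterMeasure_bind_apply]
  by_cases hx : x ∈ B σ
  · have : ∀ π : Equiv.Perm (Fin n),
        (PMF.pure ((σ, x, π) : Config n)).toOuterMeasure {z | z.2.1 ∈ B z.1} = 1 := by
      intro π
      rw [PMF.toOuterMeasure_pure_apply]
      exact if_pos hx
    simp only [this, mul_one, PMF.tsum_coe, Set.indicator_of_mem hx]
  · have : ∀ π : Equiv.Perm (Fin n),
        (PMF.pure ((σ, x, π) : Config n)).toOuterMeasure {z | z.2.1 ∈ B z.1} = 0 := by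
      intro π
      rw [PMF.toOuterMeasure_pure_apply]
      exact if_neg hx
    simp [this, Set.indicator_of_notMem hx]

/-- Conditioning on the labels: exceptional labelings are charged their full probability, the others
the uniform bound `b`. -/
lemma configLaw_toOuterMeasure_le (p q s : unitInterval)
    (B : Labeling n → Set (Sym2 (Fin n) → Bool × Bool)) (A : Set (Labeling n)) (b : ENNReal)
    (hb : ∀ σ ∉ A, (edgeLaw p q s σ).toOuterMeasure (B σ) ≤ b) :
    (configLaw n p q s).toOuterMeasure {z | z.2.1 ∈ B z.1} ≤
      (indep fun _ : Fin n => PMF.uniformOfFintype ℤˣ).toOuterMeasure A + b := by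
  classical
  set U := indep fun _ : Fin n => PMF.uniformOfFintype ℤˣ with hU
  have hsum : ∑ σ, U σ = 1 := by
    rw [← tsum_fintype (L := .unconditional _)]
    exact U.tsum_coe
  rw [configLaw_toOuterMeasure, PMF.toOuterMeasure_apply, tsum_fintype]
  calc _ ≤ ∑ σ, (A.indicator U σ + U σ * b) := by
        refine Finset.sum_le_sum fun σ _ => ?_
        by_cases hσ : σ ∈ A
        · rw [Set.indicator_of_mem hσ]
          refine le_add_right ?_
          calc U σ * (edgeLaw p q s σ).toOuterMeasure (B σ) ≤ U σ * 1 := by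
                gcongr
                rw [← PMF.toMeasure_apply_eq_toOuterMeasure]
                exact prob_le_one
            _ = U σ := mul_one _
        · rw [Set.indicator_of_notMem hσ, zero_add]
          gcongr
          exact hb σ hσ
    _ = _ := by rw [Finset.sum_add_distrib, ← Finset.sum_mul, hsum, one_mul]

end Labels

/-! ### Probability that a block has good vertices of both labels -/

section GoodPair

variable {n : ℕ}

/-- The configurations with a good vertex of either label in `H`. -/
def goodPair (M N : Finset (Bool × Bool)) (k : ℕ) (H : Finset (Fin n)) : Set (Config n) :=
  {z | ∀ c : ℤˣ, ∃ v ∈ H, z.1 v = c ∧ OuterGood M N H k z.1 z.2.1 v ∧ InnerGood N H z.2.1 v}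

/-- The probability that `k` of `h` pairs are marked and the others neutral. -/
noncomputable def binomialWeight (r a b : ℝ) (h k : ℕ) : ℝ :=
  h.choose k * (r * a) ^ k * (1 - r * b) ^ (h - k)

lemma binomialWeight_nonneg {r a b : ℝ} (hr : 0 ≤ r) (ha : 0 ≤ a) (hb : 0 ≤ 1 - r * b)
    (h k : ℕ) : 0 ≤ binomialWeight r a b h k := by
  unfold binomialWeight
  positivity

lemma edgeLaw_no_good_le (p q s : unitInterval) {M N : Finset (Bool × Bool)} (hMN : Disjoint M N)
    {a b : ℝ} (ha : 0 ≤ a) (hb : 0 ≤ b) (hb' : b ≤ 1)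
    (hM : ∀ r, (pairLaw r s False).toMeasure M = ENNReal.ofReal (r * a))
    (hN : ∀ r, (pairLaw r s False).toMeasure N = ENNReal.ofReal (1 - r * b))
    (hη : ∀ r d, (pairLaw r s d).toMeasure ((N : Set (Bool × Bool))ᶜ) ≤ ENNReal.ofReal r)
    (H : Finset (Fin n)) (k : ℕ) (σ : Labeling n) (d : ℤˣ) {c : ℝ} (hc0 : 0 ≤ c)
    (hc : c ≤ binomialWeight p a b (outerClass H σ d).card k *
      binomialWeight q a b (outerClass H σ (-d)).card k) :
    (edgeLaw p q s σ).toOuterMeasure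
        {x | ¬ ∃ v ∈ H, σ v = d ∧ OuterGood M N H k σ x v ∧ InnerGood N H x v} ≤
      ENNReal.ofReal (1 - c) ^ (H.filter fun v => σ v = d).card +
        H.card * ENNReal.ofReal (max p q) := by
  rw [← PMF.toMeasure_apply_eq_toOuterMeasure, edgeLaw, toMeasure_indep]
  have hrb : ∀ r : unitInterval, 0 ≤ 1 - (r : ℝ) * b := by
    intro r
    nlinarith [r.2.1, r.2.2]
  have h1c : ENNReal.ofReal (1 - c) = 1 - ENNReal.ofReal c := by
    rw [ENNReal.ofReal_sub _ hc0, ENNReal.ofReal_one]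
  rw [h1c]
  refine measure_no_good_le _ H k σ d (ENNReal.ofReal c) _ ?_ ?_
  · intro v hv hvd
    let r : ℤˣ → unitInterval := fun c' => if d = c' then p else q
    have hr : ∀ u ∉ H, edgeProb p q σ s(v, u) = r (σ u) := by
      intro u _
      rw [edgeProb_mk, hvd]
    have hdiag : ∀ u ∉ H, s(v, u).IsDiag = False := by
      intro u hu
      refine propext (iff_false_intro fun h => hu ?_)
      rw [Sym2.mk_isDiag_iff] at h
      exact h ▸ hv
    refine le_trans ?_ (le_measure_outerGood _ hMN k σ v
      (fun c' => ENNReal.ofReal ((r c' : ℝ) * a)) (fun c' => ENNReal.ofReal (1 - (r c' : ℝ) * b))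
      (fun u hu => by rw [hr u hu, hdiag u hu, hM]) (fun u hu => by rw [hr u hu, hdiag u hu, hN]))
    have hterm : ∀ c' : ℤˣ, ((outerClass H σ c').card.choose k : ENNReal) *
        ENNReal.ofReal ((r c' : ℝ) * a) ^ k *
          ENNReal.ofReal (1 - (r c' : ℝ) * b) ^ ((outerClass H σ c').card - k) =
        ENNReal.ofReal (binomialWeight (r c') a b (outerClass H σ c').card k) := by
      intro c'
      have h := mul_nonneg (r c').2.1 ha
      have h' := hrb (r c')
      unfold binomialWeight
      rw [← ENNReal.ofReal_pow h, ← ENNReal.ofReal_pow h', ← ENNReal.ofReal_natCast,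
        ← ENNReal.ofReal_mul (Nat.cast_nonneg _),
        ← ENNReal.ofReal_mul (mul_nonneg (Nat.cast_nonneg _) (pow_nonneg h _))]
    simp only [hterm]
    rw [← ENNReal.ofReal_prod_of_nonneg fun c' _ =>
      binomialWeight_nonneg (r c').2.1 ha (hrb _) _ _]
    refine ENNReal.ofReal_le_ofReal (hc.trans (le_of_eq ?_))
    have huniv : (Finset.univ : Finset ℤˣ) = {d, -d} :=
      (by decide : ∀ d : ℤˣ, Finset.univ = {d, -d}) d
    have hne : d ≠ -d := (by decide : ∀ d : ℤˣ, d ≠ -d) d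
    rw [huniv, Finset.prod_pair hne]
    simp [r, hne]
  · intro e
    refine (hη _ _).trans (ENNReal.ofReal_le_ofReal ?_)
    unfold edgeProb
    split_ifs
    · exact le_max_left _ _
    · exact le_max_right _ _

/-- The error has three sources: label imbalance in `H` or its complement (Chebyshev); no outer-good
vertex among at least `m` independent candidates; and a non-neutral inner pair at the vertex found.
The last two are counted once for each label. -/
lemma configLaw_compl_goodPair_le (p q s : unitInterval) {M N : Finset (Bool × Bool)}
    (hMN : Disjoint M N) {a b : ℝ} (ha : 0 ≤ a) (hb : 0 ≤ b) (hb' : b ≤ 1)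
    (hM : ∀ r, (pairLaw r s False).toMeasure M = ENNReal.ofReal (r * a))
    (hN : ∀ r, (pairLaw r s False).toMeasure N = ENNReal.ofReal (1 - r * b))
    (hη : ∀ r d, (pairLaw r s d).toMeasure ((N : Set (Bool × Bool))ᶜ) ≤ ENNReal.ofReal r)
    (H : Finset (Fin n)) (k m : ℕ) (hm : 0 < m) (hH : H.card = 4 * m) {δ : ℝ} (hδ : 0 < δ)
    (hδ' : δ ≤ 1 / 2) (hmn : (4 * m : ℝ) ≤ δ * n) {c : ℝ} (hc0 : 0 ≤ c)
    (hc : ∀ h₁ h₂ : ℕ, |(h₁ : ℝ) - n / 2| ≤ δ * n → |(h₂ : ℝ) - n / 2| ≤ δ * n →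
      c ≤ binomialWeight p a b h₁ k * binomialWeight q a b h₂ k) :
    (configLaw n p q s).toOuterMeasure (goodPair M N k H)ᶜ ≤
      ENNReal.ofReal (2 / (δ ^ 2 * m) +
        2 * (Real.exp (-(c * m)) + 4 * m * max (p : ℝ) q)) := by
  have hm' : (0 : ℝ) < m := by exact_mod_cast hm
  have hn : (8 * m : ℝ) ≤ n := by
    nlinarith [(Nat.cast_nonneg n : (0 : ℝ) ≤ n)]
  have hHc : (Hᶜ.card : ℝ) = n - 4 * m := by
    have : 4 * m ≤ n := by
      have : (4 * m : ℝ) ≤ n := by linarith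
      exact_mod_cast this
    rw [Finset.card_compl, Fintype.card_fin, hH, Nat.cast_sub this]
    push_cast
    ring
  have hHm : (H.card : ℝ) = 4 * m := by
    rw [hH]
    push_cast
    ring
  set A : Set (Labeling n) := {σ | δ * H.card < |labelSum H σ|} ∪
    {σ | δ * Hᶜ.card < |labelSum Hᶜ σ|} with hA
  set Bad : ℤˣ → Labeling n → Set (Sym2 (Fin n) → Bool × Bool) := fun d σ =>
    {x | ¬ ∃ v ∈ H, σ v = d ∧ OuterGood M N H k σ x v ∧ InnerGood N H x v} with hBad
  have hset : (goodPair M N k H)ᶜ = {z : Config n | z.2.1 ∈ Bad 1 z.1 ∪ Bad (-1) z.1} := by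
    ext z
    have hall : ∀ P : ℤˣ → Prop, (∀ c, P c) ↔ P 1 ∧ P (-1) := fun P =>
      ⟨fun h => ⟨h 1, h (-1)⟩, fun h c => by
        rcases Int.units_eq_one_or c with rfl | rfl
        exacts [h.1, h.2]⟩
    simp only [goodPair, hBad, Set.mem_compl_iff, Set.mem_ofPred_eq, Set.mem_union]
    rw [hall, not_and_or]
  have hmax : (0 : ℝ) ≤ max (p : ℝ) q := p.2.1.trans (le_max_left _ _)
  have hbad : ∀ σ ∉ A, ∀ d, (edgeLaw p q s σ).toOuterMeasure (Bad d σ) ≤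
      ENNReal.ofReal (Real.exp (-(c * m)) + 4 * m * max (p : ℝ) q) := by
    intro σ hσ d
    simp only [hA, Set.mem_union, Set.mem_ofPred_eq, not_or, not_lt] at hσ
    have hout : ∀ d', |((outerClass H σ d').card : ℝ) - n / 2| ≤ δ * n := by
      intro d'
      have h := abs_card_label_sub_le hσ.2 d'
      have heq : Hᶜ.filter (fun v => σ v = d') = outerClass H σ d' := by
        ext u
        simp [outerClass]
      rw [heq, hHc] at h
      rw [abs_le] at h ⊢
      constructor <;> nlinarith
    -- Each label occurs at least `2 * m - 2 * δ * m` times in a block of `4 * m` vertices, which is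
    -- at least `m` since `δ ≤ 1 / 2`.
    have hin : m ≤ (H.filter fun v => σ v = d).card := by
      have h := (abs_le.1 (abs_card_label_sub_le hσ.1 d)).1
      rw [hHm] at h
      have : (m : ℝ) ≤ (H.filter fun v => σ v = d).card := by nlinarith
      exact_mod_cast this
    refine (edgeLaw_no_good_le p q s hMN ha hb hb' hM hN hη H k σ d hc0
      (hc _ _ (hout d) (hout (-d)))).trans ?_
    rw [ENNReal.ofReal_add (Real.exp_pos _).le (by positivity),
      ENNReal.ofReal_mul (by positivity), ← hHm, ENNReal.ofReal_natCast]
    refine add_le_add ?_ le_rfl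
    have hle : ENNReal.ofReal (1 - c) ≤ 1 := by
      rw [← ENNReal.ofReal_one]
      exact ENNReal.ofReal_le_ofReal (by linarith)
    refine (pow_le_pow_right_of_le_one' hle hin).trans ?_
    rw [show -(c * m) = m * -c by ring, Real.exp_nat_mul, ENNReal.ofReal_pow (Real.exp_pos _).le]
    gcongr
    exact Real.one_sub_le_exp_neg c
  rw [hset]
  refine (configLaw_toOuterMeasure_le p q s (fun σ => Bad 1 σ ∪ Bad (-1) σ) A
    (ENNReal.ofReal (2 * (Real.exp (-(c * m)) + 4 * m * max (p : ℝ) q))) ?_).trans ?_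
  · intro σ hσ
    refine (measure_union_le _ _).trans ((add_le_add (hbad σ hσ 1) (hbad σ hσ (-1))).trans ?_)
    rw [← ENNReal.ofReal_add (by positivity) (by positivity)]
    exact ENNReal.ofReal_le_ofReal (by linarith)
  · rw [ENNReal.ofReal_add (by positivity) (by positivity)]
    refine add_le_add ?_ le_rfl
    refine (measure_union_le _ _).trans ((add_le_add (labelSum_chebyshev (by omega) hδ)
      (labelSum_chebyshev ?_ hδ)).trans ?_)
    · have : (0 : ℝ) < Hᶜ.card := by rw [hHc]; linarith
      exact_mod_cast this
    · rw [← ENNReal.ofReal_add (by positivity) (by positivity), hHc, hHm]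
      apply ENNReal.ofReal_le_ofReal
      have h₁ : 1 / (δ ^ 2 * (4 * m)) ≤ 1 / (δ ^ 2 * m) := by
        gcongr
        linarith
      have h₂ : 1 / (δ ^ 2 * (n - 4 * m)) ≤ 1 / (δ ^ 2 * m) := by
        gcongr
        linarith
      calc _ ≤ 1 / (δ ^ 2 * (m : ℝ)) + 1 / (δ ^ 2 * m) := add_le_add h₁ h₂
        _ = 2 / (δ ^ 2 * m) := by ring

end GoodPair

/-! ### Marked and neutral probabilities for the two choices of types -/

section PairLaw

lemma toMeasure_pairLaw_coe (r s : unitInterval) (d : Prop) (M : Finset (Bool × Bool)) :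
    (pairLaw r s d).toMeasure M =
      ENNReal.ofReal (∑ x ∈ M, pairWeight r (keepProb s d) x) := by
  rw [PMF.toMeasure_apply_finset, ENNReal.ofReal_sum_of_nonneg fun x _ => pairWeight_nonneg _ _ _]
  simp only [pairLaw_apply]

lemma keepProb_false (s : unitInterval) : keepProb s False = s := by simp [keepProb]

lemma pairLaw_unionMarked (r s : unitInterval) :
    (pairLaw r s False).toMeasure unionMarked =
      ENNReal.ofReal (r * (2 * (s : ℝ) - (s : ℝ) ^ 2)) := by
  rw [toMeasure_pairLaw_coe, keepProb_false]
  congr 1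
  simp [pairWeight]
  ring

lemma pairLaw_unionNeutral (r s : unitInterval) :
    (pairLaw r s False).toMeasure unionNeutral =
      ENNReal.ofReal (1 - r * (2 * (s : ℝ) - (s : ℝ) ^ 2)) := by
  rw [toMeasure_pairLaw_coe, keepProb_false]
  simp [pairWeight]

lemma pairLaw_compl_unionNeutral (r s : unitInterval) (d : Prop) :
    (pairLaw r s d).toMeasure ((unionNeutral : Finset (Bool × Bool)) : Set (Bool × Bool))ᶜ ≤
      ENNReal.ofReal r := by
  rw [← Finset.coe_compl, toMeasure_pairLaw_coe,
    show unionNeutralᶜ = unionMarked by decide]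
  apply ENNReal.ofReal_le_ofReal
  simp [pairWeight]
  nlinarith [r.2.1, mul_nonneg r.2.1 (sq_nonneg (1 - (keepProb s d : ℝ)))]

lemma pairLaw_firstMarked (r s : unitInterval) :
    (pairLaw r s False).toMeasure firstMarked = ENNReal.ofReal (r * ((s : ℝ) * (1 - s))) := by
  rw [toMeasure_pairLaw_coe, keepProb_false]
  simp [pairWeight]

lemma pairLaw_firstNeutral (r s : unitInterval) :
    (pairLaw r s False).toMeasure firstNeutral = ENNReal.ofReal (1 - r * s) := by
  rw [toMeasure_pairLaw_coe, keepProb_false]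
  congr 1
  simp [pairWeight]
  ring

lemma pairLaw_compl_firstNeutral (r s : unitInterval) (d : Prop) :
    (pairLaw r s d).toMeasure ((firstNeutral : Finset (Bool × Bool)) : Set (Bool × Bool))ᶜ ≤
      ENNReal.ofReal r := by
  rw [← Finset.coe_compl, toMeasure_pairLaw_coe,
    show firstNeutralᶜ = {(true, true), (true, false)} by decide]
  apply ENNReal.ofReal_le_ofReal
  simp [pairWeight]
  nlinarith [r.2.1, (keepProb s d).2.2, mul_nonneg r.2.1 (sub_nonneg.2 (keepProb s d).2.2)]

end PairLaw

/-! ### Poisson-type lower bounds -/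

section Asymptotics

/-- A crude Stirling bound, by induction from `e * (j + 1) ^ (j + 2) ≤ (j + 2) ^ (j + 2)`.
Polynomial losses are harmless, as only the exponent of `n` matters in the end. -/
lemma exp_mul_factorial_le (k : ℕ) :
    Real.exp k * (k.factorial : ℝ) ≤ Real.exp 1 * (k + 1) * (k : ℝ) ^ k := by
  have step : ∀ j : ℕ, Real.exp (j + 1 : ℕ) * ((j + 1).factorial : ℝ) ≤
      Real.exp 1 * (j + 1 : ℕ) * ((j + 1 : ℕ) : ℝ) ^ (j + 1) := by
    intro j
    induction j with
    | zero => simp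
    | succ j ih =>
      have hx : ((j + 1 : ℕ) : ℝ) ≤ ((j + 2 : ℕ) : ℝ) * Real.exp (-(1 / ((j + 2 : ℕ) : ℝ))) := by
        have h := Real.one_sub_le_exp_neg (1 / ((j + 2 : ℕ) : ℝ))
        have hpos : (0 : ℝ) < ((j + 2 : ℕ) : ℝ) := by positivity
        calc ((j + 1 : ℕ) : ℝ) = ((j + 2 : ℕ) : ℝ) * (1 - 1 / ((j + 2 : ℕ) : ℝ)) := by
              field_simp
              push_cast
              ring
          _ ≤ _ := by gcongr
      have hpow : Real.exp 1 * ((j + 1 : ℕ) : ℝ) ^ (j + 2) ≤ ((j + 2 : ℕ) : ℝ) ^ (j + 2) := by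
        have h := pow_le_pow_left₀ (by positivity) hx (j + 2)
        rw [mul_pow, ← Real.exp_nat_mul] at h
        have hone : ((j + 2 : ℕ) : ℝ) * -(1 / ((j + 2 : ℕ) : ℝ)) = -1 := by
          field_simp
        rw [hone] at h
        calc Real.exp 1 * ((j + 1 : ℕ) : ℝ) ^ (j + 2)
            ≤ Real.exp 1 * (((j + 2 : ℕ) : ℝ) ^ (j + 2) * Real.exp (-1)) := by gcongr
          _ = ((j + 2 : ℕ) : ℝ) ^ (j + 2) * (Real.exp 1 * Real.exp (-1)) := by ring
          _ = _ := by rw [← Real.exp_add]; simp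
      calc Real.exp (j + 1 + 1 : ℕ) * ((j + 1 + 1).factorial : ℝ)
          = Real.exp 1 * (j + 2 : ℕ) * (Real.exp (j + 1 : ℕ) * ((j + 1).factorial : ℝ)) := by
            rw [Nat.factorial_succ (j + 1), Nat.cast_succ (j + 1), Real.exp_add]
            push_cast
            ring
        _ ≤ Real.exp 1 * (j + 2 : ℕ) *
            (Real.exp 1 * (j + 1 : ℕ) * ((j + 1 : ℕ) : ℝ) ^ (j + 1)) := by gcongr
        _ = Real.exp 1 * (j + 2 : ℕ) * (Real.exp 1 * ((j + 1 : ℕ) : ℝ) ^ (j + 2)) := by ring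
        _ ≤ Real.exp 1 * (j + 2 : ℕ) * ((j + 2 : ℕ) : ℝ) ^ (j + 2) := by gcongr
  rcases k with _ | j
  · simp
  · refine (step j).trans ?_
    gcongr
    linarith

/-- The largest Poisson weight is at least of order one over the mean. -/
lemma exp_div_le_pow_floor_div {X : ℝ} (hX : 0 ≤ X) :
    Real.exp (X - 2) / (X + 1) ≤ X ^ ⌊X⌋₊ / (⌊X⌋₊.factorial : ℝ) := by
  set k := ⌊X⌋₊ with hk
  have hkX : (k : ℝ) ≤ X := Nat.floor_le hX
  have hXk : X < k + 1 := Nat.lt_floor_add_one X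
  have hfac : (0 : ℝ) < k.factorial := by positivity
  rw [div_le_div_iff₀ (by positivity) hfac]
  calc Real.exp (X - 2) * (k.factorial : ℝ)
      ≤ Real.exp (-1 + k) * (k.factorial : ℝ) := by
        gcongr
        linarith
    _ = Real.exp (-1) * (Real.exp k * (k.factorial : ℝ)) := by rw [Real.exp_add]; ring
    _ ≤ Real.exp (-1) * (Real.exp 1 * (k + 1) * (k : ℝ) ^ k) := by
        exact mul_le_mul_of_nonneg_left (exp_mul_factorial_le k) (Real.exp_pos _).le
    _ = (Real.exp (-1) * Real.exp 1) * ((k : ℝ) ^ k * (k + 1)) := by ring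
    _ = (k : ℝ) ^ k * (k + 1) := by rw [← Real.exp_add]; simp
    _ ≤ X ^ k * (X + 1) := by gcongr

/-- From `log (1 - x) ≥ -x / (1 - x)` and `1 / (1 - x) ≤ 1 + 2 * δ`, the latter because `x ≤ δ ≤ 1 /
2`. -/
lemma exp_neg_le_one_sub_pow {x δ : ℝ} (hx : 0 ≤ x) (hxδ : x ≤ δ) (hδ : δ ≤ 1 / 2) (h : ℕ) :
    Real.exp (-(x * (1 + 2 * δ) * h)) ≤ (1 - x) ^ h := by
  have hx1 : 0 < 1 - x := by linarith
  have hlog : -(x * (1 + 2 * δ)) ≤ Real.log (1 - x) := by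
    refine le_trans ?_ (Real.one_sub_inv_le_log_of_pos hx1)
    have : 1 - (1 - x)⁻¹ = -(x / (1 - x)) := by
      field_simp
      ring
    rw [this, neg_le_neg_iff, div_le_iff₀ hx1]
    nlinarith [mul_nonneg hx (sub_nonneg.2 hxδ), mul_nonneg hx (sub_nonneg.2 hδ),
      mul_nonneg (mul_nonneg hx (sub_nonneg.2 hxδ)) (hx.trans hxδ)]
  calc Real.exp (-(x * (1 + 2 * δ) * h)) = Real.exp (-(x * (1 + 2 * δ))) ^ h := by
        rw [← Real.exp_nat_mul]
        ring_nf
    _ ≤ (1 - x) ^ h := by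
        gcongr
        rw [← Real.exp_log hx1]
        exact Real.exp_le_exp.2 hlog

/-- Here `x` and `l` stand for `n` and `log n`. Since `h + 1 - k ≥ (1 / 2 - 2 * δ) * x`, the
binomial coefficient is at least a power over a factorial, as for a Poisson variable of mean `ρ * a
* l / 2`. -/
lemma le_binomialWeight {ρ a b δ l x : ℝ} (hρ : 0 ≤ ρ) (ha : 0 ≤ a) (hb : 0 ≤ b)
    (hδ : 0 < δ) (hδ' : δ ≤ 1 / 8) (hl : 0 ≤ l) (hx : 0 < x) (h k : ℕ)
    (hh : |(h : ℝ) - x / 2| ≤ δ * x) (hk : (k : ℝ) ≤ δ * x) (hr : ρ * l / x * b ≤ δ) :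
    ((1 - 4 * δ) * (ρ * a * l / 2)) ^ k / (k.factorial : ℝ) *
      Real.exp (-(ρ * b * l / 2 * (1 + 2 * δ) ^ 2)) ≤ binomialWeight (ρ * l / x) a b h k := by
  obtain ⟨hh₁, hh₂⟩ := abs_le.1 hh
  have hkh : k ≤ h := by
    have : (k : ℝ) ≤ h := by nlinarith
    exact_mod_cast this
  have hr0 : 0 ≤ ρ * l / x * b := by positivity
  have hchoose : ((1 / 2 - 2 * δ) * x) ^ k / (k.factorial : ℝ) ≤ (h.choose k : ℝ) := by
    refine le_trans ?_ (Nat.pow_le_choose k h)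
    have hcast : ((h + 1 - k : ℕ) : ℝ) = h + 1 - k := by
      rw [Nat.cast_sub (by omega)]
      push_cast
      ring
    have h0 : 0 ≤ (1 / 2 - 2 * δ) * x := mul_nonneg (by linarith) hx.le
    gcongr
    rw [hcast]
    linarith
  have hpow : ((1 - 4 * δ) * (ρ * a * l / 2)) ^ k / (k.factorial : ℝ) ≤
      h.choose k * (ρ * l / x * a) ^ k := by
    calc ((1 - 4 * δ) * (ρ * a * l / 2)) ^ k / (k.factorial : ℝ)
        = ((1 / 2 - 2 * δ) * x) ^ k / (k.factorial : ℝ) * (ρ * l / x * a) ^ k := by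
          rw [div_mul_eq_mul_div, ← mul_pow]
          congr 2
          field_simp
          ring
      _ ≤ _ := by gcongr
  have hexp : Real.exp (-(ρ * b * l / 2 * (1 + 2 * δ) ^ 2)) ≤ (1 - ρ * l / x * b) ^ (h - k) := by
    calc Real.exp (-(ρ * b * l / 2 * (1 + 2 * δ) ^ 2))
        ≤ Real.exp (-(ρ * l / x * b * (1 + 2 * δ) * h)) := by
          refine Real.exp_le_exp.2 (neg_le_neg ?_)
          have : (h : ℝ) ≤ x / 2 * (1 + 2 * δ) := by linarith
          calc ρ * l / x * b * (1 + 2 * δ) * h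
              ≤ ρ * l / x * b * (1 + 2 * δ) * (x / 2 * (1 + 2 * δ)) := by gcongr
            _ = _ := by
              field_simp
      _ ≤ (1 - ρ * l / x * b) ^ h := exp_neg_le_one_sub_pow hr0 hr (by linarith) h
      _ ≤ (1 - ρ * l / x * b) ^ (h - k) :=
          pow_le_pow_of_le_one (by linarith) (by linarith) (Nat.sub_le _ _)
  unfold binomialWeight
  gcongr

/-- With the same `k` for both communities, the two Poisson powers multiply to `X ^ (2 * k)`, where
`X` is the geometric mean of the two means. Taking `k = ⌊X⌋₊` makes `(X ^ k / k!) ^ 2` about `exp (2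
* X)`, the source of the term `a * √(α * β)`. -/
lemma le_binomialWeight_mul {α β a b δ l x : ℝ} (hα : 0 ≤ α) (hβ : 0 ≤ β) (ha : 0 ≤ a)
    (hb : 0 ≤ b) (hδ : 0 < δ) (hδ' : δ ≤ 1 / 8) (hl : 0 ≤ l) (hx : 0 < x)
    (hX : a * √(α * β) * l / 2 ≤ δ * x) (hα' : α * l / x * b ≤ δ) (hβ' : β * l / x * b ≤ δ)
    (h₁ h₂ : ℕ) (hh₁ : |(h₁ : ℝ) - x / 2| ≤ δ * x) (hh₂ : |(h₂ : ℝ) - x / 2| ≤ δ * x) :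
    Real.exp (-((b * ((α + β) / 2) * (1 + 2 * δ) ^ 2 - a * √(α * β) +
        8 * δ * (a * √(α * β))) * l) - 4) / (a * √(α * β) * l / 2 + 1) ^ 2 ≤
      binomialWeight (α * l / x) a b h₁ ⌊a * √(α * β) * l / 2⌋₊ *
        binomialWeight (β * l / x) a b h₂ ⌊a * √(α * β) * l / 2⌋₊ := by
  set X := a * √(α * β) * l / 2 with hXdef
  have hX0 : 0 ≤ X := by positivity
  set k := ⌊X⌋₊ with hk
  have hkX : (k : ℝ) ≤ X := Nat.floor_le hX0
  have h4δ : 0 ≤ 1 - 4 * δ := by linarith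
  have e₁ := le_binomialWeight hα ha hb hδ hδ' hl hx h₁ k hh₁ (hkX.trans hX) hα'
  have e₂ := le_binomialWeight hβ ha hb hδ hδ' hl hx h₂ k hh₂ (hkX.trans hX) hβ'
  refine le_trans ?_ (mul_le_mul e₁ e₂ (by positivity) (le_trans (by positivity) e₁))
  have hXX : (α * a * l / 2) * (β * a * l / 2) = X ^ 2 := by
    have := Real.mul_self_sqrt (mul_nonneg hα hβ)
    rw [hXdef]
    linear_combination (-(a ^ 2 * l ^ 2 / 4)) * this
  have hδk : Real.exp (-(16 * δ * X)) ≤ (1 - 4 * δ) ^ (2 * k) := by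
    refine le_trans ?_ (exp_neg_le_one_sub_pow (δ := 4 * δ) (by linarith) le_rfl
      (by linarith) (2 * k))
    refine Real.exp_le_exp.2 (neg_le_neg ?_)
    push_cast
    have hk0 : (0 : ℝ) ≤ k := Nat.cast_nonneg k
    calc 4 * δ * (1 + 2 * (4 * δ)) * (2 * (k : ℝ)) ≤ 4 * δ * 2 * (2 * X) := by
          gcongr
          linarith
      _ = 16 * δ * X := by ring
  have hP := exp_div_le_pow_floor_div hX0
  have hE : Real.exp (-((b * ((α + β) / 2) * (1 + 2 * δ) ^ 2 - a * √(α * β) +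
        8 * δ * (a * √(α * β))) * l) - 4) =
      Real.exp (-(16 * δ * X)) * Real.exp (X - 2) ^ 2 *
        (Real.exp (-(α * b * l / 2 * (1 + 2 * δ) ^ 2)) *
          Real.exp (-(β * b * l / 2 * (1 + 2 * δ) ^ 2))) := by
    rw [← Real.exp_nat_mul, ← Real.exp_add, ← Real.exp_add, ← Real.exp_add, hXdef]
    congr 1
    push_cast
    ring
  calc Real.exp (-((b * ((α + β) / 2) * (1 + 2 * δ) ^ 2 - a * √(α * β) +
        8 * δ * (a * √(α * β))) * l) - 4) / (X + 1) ^ 2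
      = Real.exp (-(16 * δ * X)) * (Real.exp (X - 2) / (X + 1)) ^ 2 *
        (Real.exp (-(α * b * l / 2 * (1 + 2 * δ) ^ 2)) *
          Real.exp (-(β * b * l / 2 * (1 + 2 * δ) ^ 2))) := by
        rw [hE, div_pow]
        ring
    _ ≤ (1 - 4 * δ) ^ (2 * k) * (X ^ k / (k.factorial : ℝ)) ^ 2 *
        (Real.exp (-(α * b * l / 2 * (1 + 2 * δ) ^ 2)) *
          Real.exp (-(β * b * l / 2 * (1 + 2 * δ) ^ 2))) := by gcongr
    _ = (1 - 4 * δ) ^ (2 * k) * ((α * a * l / 2) * (β * a * l / 2)) ^ k /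
          (k.factorial : ℝ) ^ 2 * (Real.exp (-(α * b * l / 2 * (1 + 2 * δ) ^ 2)) *
          Real.exp (-(β * b * l / 2 * (1 + 2 * δ) ^ 2))) := by
        rw [hXX, div_pow, pow_right_comm X 2 k,
          ← mul_div_assoc ((1 - 4 * δ) ^ (2 * k))]
    _ = _ := by
        rw [mul_pow, mul_pow, mul_pow]
        ring

lemma tendsto_log_div_natCast : Tendsto (fun n : ℕ => Real.log n / n) atTop (𝓝 0) :=
  (Real.isLittleO_log_id_atTop.tendsto_div_nhds_zero).comp tendsto_natCast_atTop_atTop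

lemma eventually_mul_log_div_le (C : ℝ) {δ : ℝ} (hδ : 0 < δ) :
    ∀ᶠ n : ℕ in atTop, C * (Real.log n / n) ≤ δ := by
  have h := tendsto_log_div_natCast.const_mul C
  rw [mul_zero] at h
  exact h.eventually_le_const hδ

lemma eventually_sq_le_exp (C : ℝ) {ε : ℝ} (hC : 0 ≤ C) (hε : 0 < ε) :
    ∀ᶠ l : ℝ in atTop, (C * l + 1) ^ 2 ≤ Real.exp (ε * l - 4) := by
  have hO := (isLittleO_pow_exp_pos_mul_atTop 2 hε).bound
    (show 0 < Real.exp (-4) / (C + 1) ^ 2 by positivity)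
  filter_upwards [hO, eventually_ge_atTop 1] with l hl hl1
  rw [Real.norm_of_nonneg (by positivity), Real.norm_of_nonneg (Real.exp_pos _).le,
    div_mul_eq_mul_div, le_div_iff₀ (by positivity), ← Real.exp_add] at hl
  calc (C * l + 1) ^ 2 ≤ (C * l + l) ^ 2 := by gcongr
    _ = l ^ 2 * (C + 1) ^ 2 := by ring
    _ ≤ Real.exp (-4 + ε * l) := hl
    _ = _ := by ring_nf

lemma exists_rpow_le_binomialWeight_mul {α β a b : ℝ} (hα : 0 < α) (hβ : 0 < β) (ha : 0 ≤ a)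
    (hb : 0 ≤ b) (hθ : b * ((α + β) / 2) - a * √(α * β) < 1) :
    ∃ δ θ : ℝ, 0 < δ ∧ δ ≤ 1 / 8 ∧ 0 < θ ∧ θ < 1 ∧ ∃ k : ℕ → ℕ, ∀ᶠ n : ℕ in atTop,
      ∀ h₁ h₂ : ℕ, |(h₁ : ℝ) - n / 2| ≤ δ * n → |(h₂ : ℝ) - n / 2| ≤ δ * n →
        (n : ℝ) ^ (-θ) ≤ binomialWeight (α * Real.log n / n) a b h₁ (k n) *
          binomialWeight (β * Real.log n / n) a b h₂ (k n) := by
  set g : ℝ → ℝ := fun δ => b * ((α + β) / 2) * (1 + 2 * δ) ^ 2 - a * √(α * β) +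
    8 * δ * (a * √(α * β)) with hg
  have hgc : Continuous g := by fun_prop
  have hg0 : g 0 < 1 := by simpa [hg] using hθ
  obtain ⟨δ, ⟨hgδ, hδ'⟩, hδ⟩ : ∃ δ, (g δ < 1 ∧ δ < 1 / 8) ∧ 0 < δ := by
    have h₁ : ∀ᶠ δ in 𝓝[>] (0 : ℝ), g δ < 1 ∧ δ < 1 / 8 :=
      ((hgc.continuousAt.eventually_lt_const hg0).and
        (eventually_lt_nhds (by norm_num))).filter_mono nhdsWithin_le_nhds
    exact (h₁.and self_mem_nhdsWithin).exists
  -- A midpoint between the exponent and 1: the gap above `g δ` absorbs the polynomial factors in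
  -- `log n`, and the maximum with 0 keeps `θ` positive.
  set θ : ℝ := (max (g δ) 0 + 1) / 2 with hθdef
  have hmax : max (g δ) 0 < 1 := max_lt hgδ one_pos
  have hmax0 : 0 ≤ max (g δ) 0 := le_max_right _ _
  have hgθ : g δ < θ := by
    have := le_max_left (g δ) 0
    linarith
  set C := a * √(α * β) / 2 with hC
  have hC0 : 0 ≤ C := by positivity
  refine ⟨δ, θ, hδ, hδ'.le, by linarith, by linarith,
    fun n => ⌊a * √(α * β) * Real.log n / 2⌋₊, ?_⟩
  have hlog : Tendsto (fun n : ℕ => Real.log n) atTop atTop :=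
    Real.tendsto_log_atTop.comp tendsto_natCast_atTop_atTop
  filter_upwards [eventually_mul_log_div_le C hδ, eventually_mul_log_div_le (α * b) hδ,
    eventually_mul_log_div_le (β * b) hδ,
    hlog.eventually (eventually_sq_le_exp C hC0 (sub_pos.2 hgθ)),
    eventually_ge_atTop 2] with n hn₁ hn₂ hn₃ hn₄ hn₅ h₁ h₂ hh₁ hh₂
  have hn : (0 : ℝ) < n := by positivity
  have hl : 0 ≤ Real.log n := Real.log_natCast_nonneg n
  have hXC : a * √(α * β) * Real.log n / 2 = C * Real.log n := by rw [hC]; ring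
  refine le_trans ?_ (le_binomialWeight_mul hα.le hβ.le ha hb hδ hδ'.le hl hn ?_ ?_ ?_ h₁ h₂
    hh₁ hh₂)
  · rw [hXC, le_div_iff₀ (by positivity), Real.rpow_def_of_pos hn]
    calc Real.exp (Real.log n * -θ) * (C * Real.log n + 1) ^ 2
        ≤ Real.exp (Real.log n * -θ) * Real.exp ((θ - g δ) * Real.log n - 4) := by gcongr
      _ = _ := by
        rw [← Real.exp_add]
        congr 1
        simp only [hg]
        ring
  · rw [hXC, ← div_le_iff₀ hn]
    simpa [mul_div_assoc] using hn₁
  · calc α * Real.log n / n * b = α * b * (Real.log n / n) := by ring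
      _ ≤ δ := hn₂
  · calc β * Real.log n / n * b = β * b * (Real.log n / n) := by ring
      _ ≤ δ := hn₃

end Asymptotics

/-! ### Choice of the blocks and passage to the limit -/

section Limit

lemma exists_disjoint_blocks {n K t : ℕ} (h : K * t ≤ n) :
    ∃ H : Fin K → Finset (Fin n), (Pairwise fun i j => Disjoint (H i) (H j)) ∧
      ∀ j, (H j).card = t := by
  let f : Fin K × Fin t → Fin n := fun x => Fin.castLE h (finProdFinEquiv x)
  have hf : Function.Injective f :=
    (Fin.castLE_injective h).comp finProdFinEquiv.injective
  refine ⟨fun j => Finset.univ.image fun i => f (j, i), fun j j' hj => ?_, fun j => ?_⟩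
  · refine Finset.disjoint_left.2 fun v hv hv' => hj ?_
    obtain ⟨i, -, rfl⟩ := Finset.mem_image.1 hv
    obtain ⟨i', -, h'⟩ := Finset.mem_image.1 hv'
    exact (congrArg Prod.fst (hf h')).symm
  · rw [Finset.card_image_of_injective _ fun i i' hi => congrArg Prod.snd (hf hi)]
    simp

/-- The number of vertices in a quarter of a block. -/
noncomputable def blockSize (κ : ℝ) (n : ℕ) : ℕ := ⌊(n : ℝ) ^ κ⌋₊

lemma blockSize_le (κ : ℝ) (n : ℕ) : (blockSize κ n : ℝ) ≤ (n : ℝ) ^ κ :=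
  Nat.floor_le (Real.rpow_nonneg (Nat.cast_nonneg n) κ)

lemma tendsto_natCast_rpow {κ : ℝ} (hκ : 0 < κ) :
    Tendsto (fun n : ℕ => (n : ℝ) ^ κ) atTop atTop :=
  (tendsto_rpow_atTop hκ).comp tendsto_natCast_atTop_atTop

lemma tendsto_blockSize {κ : ℝ} (hκ : 0 < κ) : Tendsto (blockSize κ) atTop atTop :=
  tendsto_nat_floor_atTop.comp (tendsto_natCast_rpow hκ)

lemma eventually_mul_blockSize_le {κ : ℝ} (hκ : κ < 1) (C : ℝ) {δ : ℝ} (hδ : 0 < δ) (hC : 0 ≤ C) :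
    ∀ᶠ n : ℕ in atTop, C * blockSize κ n ≤ δ * n := by
  filter_upwards [(tendsto_natCast_rpow (sub_pos.2 hκ)).eventually_ge_atTop (C / δ),
    eventually_gt_atTop 0] with n hn hn0
  have hn0' : (0 : ℝ) < n := by exact_mod_cast hn0
  have hpow : (n : ℝ) ^ κ * (n : ℝ) ^ (1 - κ) = n := by
    rw [← Real.rpow_add hn0', add_sub_cancel, Real.rpow_one]
  have hnκ : 0 < (n : ℝ) ^ κ := Real.rpow_pos_of_pos hn0' κ
  rw [div_le_iff₀ hδ] at hn
  calc C * blockSize κ n ≤ C * (n : ℝ) ^ κ := by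
        gcongr
        exact blockSize_le κ n
    _ ≤ ((n : ℝ) ^ (1 - κ) * δ) * (n : ℝ) ^ κ := by gcongr
    _ = δ * ((n : ℝ) ^ κ * (n : ℝ) ^ (1 - κ)) := by ring
    _ = δ * n := by rw [hpow]

/-- The block exponent is the midpoint of `θ` and 1. Being above `θ`, it makes the expected number
of good vertices diverge; being below 1, it makes the inner pairs negligible despite the factor `log
n`. -/
lemma tendsto_block_error {θ δ C : ℝ} (hθ : θ < 1) (hθ0 : 0 < θ) :
    Tendsto (fun n : ℕ => 2 / (δ ^ 2 * blockSize ((1 + θ) / 2) n) +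
      2 * (Real.exp (-((n : ℝ) ^ (-θ) * blockSize ((1 + θ) / 2) n)) +
        4 * ((n : ℝ) ^ ((1 + θ) / 2) * (C * (Real.log n / n))))) atTop (𝓝 0) := by
  set κ := (1 + θ) / 2 with hκ
  have h₁ : Tendsto (fun n : ℕ => 2 / (δ ^ 2 * (blockSize κ n : ℝ))) atTop (𝓝 0) := by
    have h : Tendsto (fun n : ℕ => (2 / δ ^ 2) * (blockSize κ n : ℝ)⁻¹) atTop (𝓝 (2 / δ ^ 2 * 0)) :=
      (tendsto_inv_atTop_zero.comp (tendsto_natCast_atTop_atTop.comp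
        (tendsto_blockSize (by linarith)))).const_mul _
    rw [mul_zero] at h
    refine h.congr fun n => ?_
    rw [div_mul_eq_div_div, div_eq_mul_inv (2 / δ ^ 2)]
  have h₂ : Tendsto (fun n : ℕ => Real.exp (-((n : ℝ) ^ (-θ) * blockSize κ n))) atTop (𝓝 0) := by
    refine Real.tendsto_exp_neg_atTop_nhds_zero.comp ?_
    refine tendsto_atTop_mono' _ ?_ (tendsto_atTop_add_const_right _ (-1 : ℝ)
      (tendsto_natCast_rpow (show 0 < κ - θ by linarith)))
    filter_upwards [eventually_ge_atTop 1] with n hn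
    have hn1 : (1 : ℝ) ≤ n := by exact_mod_cast hn
    have hn0 : (0 : ℝ) < n := by linarith
    have hle : (n : ℝ) ^ (-θ) ≤ 1 := Real.rpow_le_one_of_one_le_of_nonpos hn1 (by linarith)
    have hfl : (n : ℝ) ^ κ - 1 ≤ blockSize κ n := (Nat.sub_one_lt_floor _).le
    calc (n : ℝ) ^ (κ - θ) + -1 ≤ (n : ℝ) ^ (κ - θ) - (n : ℝ) ^ (-θ) := by linarith
      _ = (n : ℝ) ^ (-θ) * ((n : ℝ) ^ κ - 1) := by
        rw [mul_sub, ← Real.rpow_add hn0, mul_one]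
        ring_nf
      _ ≤ _ := by gcongr
  have h₃ : Tendsto (fun n : ℕ => (n : ℝ) ^ κ * (C * (Real.log n / n))) atTop (𝓝 0) := by
    have h := (((isLittleO_log_rpow_atTop (show 0 < 1 - κ by linarith)).tendsto_div_nhds_zero).comp
      tendsto_natCast_atTop_atTop).const_mul C
    rw [mul_zero] at h
    refine h.congr' ?_
    filter_upwards [eventually_ge_atTop 1] with n hn
    have hn0 : (0 : ℝ) < n := by exact_mod_cast hn
    simp only [Function.comp]
    rw [Real.rpow_sub hn0, Real.rpow_one]
    field_simp
  simpa using h₁.add ((h₂.add (h₃.const_mul 4)).const_mul 2)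

/-- If the expected number of good vertices diverges, and exchanging two good vertices of opposite
labels does not decrease the likelihood, then no estimator recovers the labels exactly. -/
lemma tendsto_success_zero {α β a b : ℝ} (hα : 0 < α) (hβ : 0 < β) (ha : 0 ≤ a) (hb : 0 ≤ b)
    (hb' : b ≤ 1) (hθ : b * ((α + β) / 2) - a * √(α * β) < 1) (s : unitInterval)
    (p q : ℕ → unitInterval)
    (hp : ∀ᶠ n : ℕ in atTop, (p n : ℝ) = α * Real.log n / n)
    (hq : ∀ᶠ n : ℕ in atTop, (q n : ℝ) = β * Real.log n / n)
    {M N : Finset (Bool × Bool)} (hMN : Disjoint M N)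
    (hM : ∀ r, (pairLaw r s False).toMeasure M = ENNReal.ofReal (r * a))
    (hN : ∀ r, (pairLaw r s False).toMeasure N = ENNReal.ofReal (1 - r * b))
    (hη : ∀ r d, (pairLaw r s d).toMeasure ((N : Set (Bool × Bool))ᶜ) ≤ ENNReal.ofReal r)
    (Φ : ∀ n, Equiv.Perm (Fin n) → Config n → Config n)
    (hΦ : ∀ n v w z, Φ n (Equiv.swap v w) (Φ n (Equiv.swap v w) z) = z)
    (hσ : ∀ n τ z, (Φ n τ z).1 = z.1 ∘ τ)
    (h₁ : ∀ n τ z, (Φ n τ z).toOutcome.G₁ = z.toOutcome.G₁)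
    (h₂ : ∀ n v w z, (Φ n (Equiv.swap v w) z).toOutcome.G₂ = z.toOutcome.G₂)
    (hlik : ∀ᶠ n in atTop, ∀ (H : Finset (Fin n)) (k : ℕ) (z : Config n) (v w : Fin n),
      v ≠ w → v ∈ H → w ∈ H → InnerGood N H z.2.1 v → InnerGood N H z.2.1 w →
      OuterGood M N H k z.1 z.2.1 v → OuterGood M N H k z.1 z.2.1 w →
      edgeLaw (p n) (q n) s z.1 z.2.1 ≤ edgeLaw (p n) (q n) s (Φ n (Equiv.swap v w) z).1
        (Φ n (Equiv.swap v w) z).2.1)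
    (est : ∀ n, Estimator n) :
    Tendsto (fun n => (configLaw n (p n) (q n) s).toOuterMeasure (successSet (est n)))
      atTop (𝓝 0) := by
  obtain ⟨δ, θ, hδ, hδ', hθ0, hθ1, k, hk⟩ := exists_rpow_le_binomialWeight_mul hα hβ ha hb hθ
  set κ := (1 + θ) / 2 with hκ
  set err : ℕ → ℝ := fun n => 2 / (δ ^ 2 * blockSize κ n) +
      2 * (Real.exp (-((n : ℝ) ^ (-θ) * blockSize κ n)) +
        4 * ((n : ℝ) ^ κ * ((α + β) * (Real.log n / n)))) with herr
  have herr0 : Tendsto err atTop (𝓝 0) := tendsto_block_error hθ1 hθ0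
  -- The number of blocks stays fixed while `n` grows, so the union bound over blocks costs only a
  -- constant factor; `K` is chosen from `ε` afterwards.
  have key : ∀ K : ℕ, 0 < K → ∀ᶠ n in atTop,
      (configLaw n (p n) (q n) s).toOuterMeasure (successSet (est n)) ≤
        2 / K + K * ENNReal.ofReal (err n) := by
    intro K hK
    filter_upwards [hp, hq, hk, hlik,
      (tendsto_blockSize (show 0 < κ by linarith)).eventually_gt_atTop 0,
      eventually_mul_blockSize_le (show κ < 1 by linarith) 4 hδ (by norm_num),
      eventually_mul_blockSize_le (show κ < 1 by linarith) (K * 4) one_pos (by positivity)]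
      with n hpn hqn hkn hln hm0 hm₁ hm₂
    obtain ⟨H, hH, hcard⟩ := exists_disjoint_blocks (n := n) (K := K) (t := 4 * blockSize κ n) (by
      have : ((K * (4 * blockSize κ n) : ℕ) : ℝ) ≤ n := by
        push_cast
        linarith
      exact_mod_cast this)
    refine (success_le hK _ (est n) H hH (Φ n) (hΦ n) (hσ n) (h₁ n) (h₂ n)
      (fun j => goodPair M N (k n) (H j)) ?_).trans ?_
    · intro j z hz
      obtain ⟨v, hv, hv1, hvout, hvin⟩ := hz 1
      obtain ⟨w, hw, hw1, hwout, hwin⟩ := hz (-1)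
      have hne : z.1 v ≠ z.1 w := by
        rw [hv1, hw1]
        decide
      refine ⟨v, hv, w, hw, hne, ?_⟩
      rw [configLaw_apply, configLaw_apply, uniform_labels_apply, uniform_labels_apply]
      gcongr
      exact hln (H j) (k n) z v w (fun h => hne (by rw [h])) hv hw hvin hwin hvout hwout
    · gcongr
      have hlog : 0 ≤ Real.log n / n := div_nonneg (Real.log_natCast_nonneg n) (Nat.cast_nonneg n)
      have hmax : max (p n : ℝ) (q n) ≤ (α + β) * (Real.log n / n) := by
        rw [hpn, hqn, mul_div_assoc, mul_div_assoc]
        refine max_le ?_ ?_ <;> nlinarith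
      have hj : ∀ j, (configLaw n (p n) (q n) s).toOuterMeasure (goodPair M N (k n) (H j))ᶜ ≤
          ENNReal.ofReal (err n) := by
        intro j
        refine (configLaw_compl_goodPair_le (p n) (q n) s hMN ha hb hb' hM hN hη (H j) (k n)
          (blockSize κ n) hm0 (hcard j) hδ (by linarith) hm₁ (c := (n : ℝ) ^ (-θ))
          (Real.rpow_nonneg (Nat.cast_nonneg n) _) ?_).trans (ENNReal.ofReal_le_ofReal ?_)
        · rw [hpn, hqn]
          exact hkn
        · simp only [herr]
          have hmm : (blockSize κ n : ℝ) * max (p n : ℝ) (q n) ≤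
              (n : ℝ) ^ κ * ((α + β) * (Real.log n / n)) :=
            mul_le_mul (blockSize_le κ n) hmax ((p n).2.1.trans (le_max_left _ _))
              (Real.rpow_nonneg (Nat.cast_nonneg n) _)
          linarith
      calc _ ≤ ∑ _j : Fin K, ENNReal.ofReal (err n) := Finset.sum_le_sum fun j _ => hj j
        _ = K * ENNReal.ofReal (err n) := by simp
  rw [ENNReal.tendsto_nhds_zero]
  intro ε hε
  obtain ⟨K, hK, hKε⟩ : ∃ K : ℕ, 0 < K ∧ (2 : ENNReal) / K ≤ ε / 2 := by
    have h : Tendsto (fun K : ℕ => (2 : ENNReal) / K) atTop (𝓝 0) :=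
      ENNReal.Tendsto.const_div ENNReal.tendsto_nat_nhds_top (by simp) |>.trans (by simp)
    exact ((eventually_gt_atTop 0).and (h.eventually_le_const
      (ENNReal.half_pos hε.ne'))).exists
  have hlim : Tendsto (fun n => (K : ENNReal) * ENNReal.ofReal (err n)) atTop (𝓝 0) := by
    have h := ENNReal.Tendsto.const_mul (a := (K : ENNReal)) (ENNReal.tendsto_ofReal herr0)
      (Or.inr (by simp))
    simpa using h
  filter_upwards [key K hK, ENNReal.tendsto_nhds_zero.1 hlim (ε / 2) (ENNReal.half_pos hε.ne')]
    with n hn hn'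
  exact hn.trans ((add_le_add hKε hn').trans_eq (ENNReal.add_halves ε))

lemma eventually_edge_prob_mem {α : ℝ} (hα : 0 < α) {p : ℕ → unitInterval}
    (hp : ∀ᶠ n : ℕ in atTop, (p n : ℝ) = α * Real.log n / n) :
    ∀ᶠ n in atTop, 0 < (p n : ℝ) ∧ (p n : ℝ) < 1 := by
  filter_upwards [hp, eventually_mul_log_div_le α (show (0 : ℝ) < 1 / 2 by norm_num),
    eventually_ge_atTop 2] with n hn hn' hn2
  have hn1 : (1 : ℝ) < n := by exact_mod_cast hn2
  have := Real.log_pos hn1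
  rw [← mul_div_assoc] at hn'
  rw [hn]
  exact ⟨by positivity, by linarith⟩

lemma DPlus_eq {α β : ℝ} (hα : 0 ≤ α) (hβ : 0 ≤ β) :
    DPlus α β = (α + β) / 2 - √(α * β) := by
  rw [DPlus, div_pow, Real.sq_sqrt (by norm_num), Real.sqrt_mul hα, sub_sq, Real.sq_sqrt hα,
    Real.sq_sqrt hβ]
  ring

lemma CSBM_toMeasure_eq {n : ℕ} (p q s : unitInterval) (est : Estimator n) :
    (CSBM n p q s).toMeasure {ω | overlap (est ω.G₁ ω.G₂) ω.σ = 1} =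
      (configLaw n p q s).toOuterMeasure (successSet est) := by
  rw [PMF.toMeasure_apply_eq_toOuterMeasure_apply _ MeasurableSpace.measurableSet_top, CSBM_eq_map,
    PMF.toOuterMeasure_map_apply]
  rfl

end Limit

end CorrelatedSBM

/-! ### The impossibility theorem -/

open CorrelatedSBM
theorem theorem2 (α β : ℝ) (hα : 0 < α) (hβ : 0 < β) (s : unitInterval) (p q : ℕ → unitInterval)
    (hp : ∀ᶠ n : ℕ in atTop, (p n : ℝ) = α * Real.log n / n)
    (hq : ∀ᶠ n : ℕ in atTop, (q n : ℝ) = β * Real.log n / n)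
    (h : (1 - (1 - (s : ℝ)) ^ 2) * DPlus α β < 1 ∨
      (s : ℝ) ^ 2 * Tc α β + (s : ℝ) * (1 - (s : ℝ)) * DPlus α β < 1)
    (σ' : ∀ n : ℕ, Estimator n) :
    Tendsto (fun n : ℕ => (CSBM n (p n) (q n) s).toMeasure
      {ω | overlap (σ' n ω.G₁ ω.G₂) ω.σ = 1}) atTop (𝓝 0) := by
  simp only [CSBM_toMeasure_eq]
  have hs0 : 0 ≤ (s : ℝ) := s.2.1
  have hs1 : (s : ℝ) ≤ 1 := s.2.2
  have hD := DPlus_eq hα.le hβ.le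
  have hsqrt := Real.sqrt_nonneg (α * β)
  -- Splitting on the first condition itself, and not on the disjunction, makes its failure
  -- available in the other branch, where it excludes `s = 1`.
  by_cases hcase : (1 - (1 - (s : ℝ)) ^ 2) * DPlus α β < 1
  · refine tendsto_success_zero (a := 2 * (s : ℝ) - (s : ℝ) ^ 2) (b := 2 * (s : ℝ) - (s : ℝ) ^ 2)
      hα hβ (by nlinarith) (by nlinarith) (by nlinarith [sq_nonneg (1 - (s : ℝ))]) ?_ s p q hp hq
      (M := unionMarked) (N := unionNeutral) (by decide) (fun r => pairLaw_unionMarked r s)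
      (fun r => pairLaw_unionNeutral r s) (fun r d => pairLaw_compl_unionNeutral r s d)
      (fun n => unionMove) (fun n => unionMove_unionMove) (fun _ _ _ => rfl) (fun _ _ _ => rfl)
      (fun _ _ _ _ => rfl) ?_ σ'
    · rw [hD] at hcase
      linarith
    · filter_upwards [eventually_edge_prob_mem hα hp, eventually_edge_prob_mem hβ hq]
        with n hpn hqn H k z v w hvw hv hw hvin hwin hvout hwout
      exact (edgeLaw_swap_union hpn.2 hqn.2 s hvw hv hw hvin hwin hvout hwout).le
  · have h' := h.resolve_left hcase
    rw [Tc, hD] at h'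
    -- At `s = 1` the second condition reads `Tc α β < 1`, which implies the first because `DPlus α
    -- β ≤ Tc α β`. Strictness is needed because `commonRatio` divides by `(1 - t) ^ 2`.
    have hs : (s : ℝ) < 1 := by
      refine lt_of_le_of_ne hs1 fun hs => hcase ?_
      rw [hs] at h' ⊢
      rw [hD]
      linarith
    refine tendsto_success_zero (a := (s : ℝ) * (1 - s)) (b := s)
      hα hβ (mul_nonneg hs0 (by linarith)) hs0 hs1 ?_ s p q hp hq
      (M := firstMarked) (N := firstNeutral) (by decide) (fun r => pairLaw_firstMarked r s)
      (fun r => pairLaw_firstNeutral r s) (fun r d => pairLaw_compl_firstNeutral r s d)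
      (fun n => firstMove) (fun n => firstMove_firstMove) (fun _ _ _ => rfl) (fun _ _ _ => rfl)
      (fun n => firstMove_G₂) ?_ σ'
    -- The exponent `s * (α + β) / 2 - s * (1 - s) * √(α * β)` is the second quantity of the
    -- hypothesis, since `s = s ^ 2 + s * (1 - s)`.
    · linarith
    · filter_upwards [eventually_edge_prob_mem hα hp, eventually_edge_prob_mem hβ hq]
        with n hpn hqn H k z v w hvw hv hw hvin hwin hvout hwout
      exact edgeLaw_le_swap_first hpn.2 hqn.2 hpn.1 hqn.1 hs hvw hv hw hvin hwin hvout hwout
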